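/- Let $M$ be a connected smooth manifold (manifolds are finite-dimensional, Hausdorff, paracompact and smooth), let $G$ be a connected Lie group with identity $e$, and let $\rho:\tilde G\to G$ be its universal covering group, i.e. a simply connected Lie group $\tilde G$ with a homomorphism $\rho$ that is a smooth covering map. Let $\pi:P\to M$ be a smooth principal $G$-bundle (with right $G$-action), fix $p_0\in P$, put $m_0=\pi(p_0)$, and let $i:G\to P$, $i(g)=p_0g$. Write $\pi_1(P)=\pi_1(P,p_0)$, $\pi_1(M)=\pi_1(M,m_0)$, $\pi_1(G)=\pi_1(G,e)$, with induced homomorphisms $i_*:\pi_1(G)\to\pi_1(P)$ and $\pi_*:\pi_1(P)\to\pi_1(M)$. A spinor structure for $P$ is a smooth principal $\tilde G$-bundle $\pi_Q:Q\to M$ together with a smooth map $u:Q\to P$ such that $\pi\circ u=\pi_Q$ and $u(q\tilde g)=u(q)\rho(\tilde g)$ for all $q\in Q$, $\tilde g\in\tilde G$. Two spinor structures $u:Q\to P$ and $u':Q'\to P$ are equivalent if there is a morphism of principal $\tilde G$-bundles over $M$ (a smooth $\tilde G$-equivariant map over $\mathrm{id}_M$) $a:Q\to Q'$ with $u'\circ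 a=u$. Call a subgroup $K\le\pi_1(P)$ a complement if $\pi_1(P)$ is the internal direct product $K\times i_*(\pi_1(G))$ and $\pi_*$ restricts to an isomorphism $K\to\pi_1(M)$. Suppose that $i_*$ is injective and that a complement exists (the conditions of the Existence Theorem). Then: 1. Equivalence of spinor structures is an equivalence relation, and $[u:Q\to P]\mapsto u_*(\pi_1(Q,q_0))$, where $q_0$ is any point of $u^{-1}(p_0)$, is a well-defined bijection from the set of equivalence classes of spinor structures for $P$ onto the set of complements. 2. Fix a spinor structure $S_0$ for $P$ with corresponding complement $K_0$. Then there is a bijection from the set of equivalence classes of spinor structures for $P$ onto the set of group homomorphisms $\pi_1(M)\to\pi_1(G)$, which sends the class of $S_0$ to the trivial homomorphism, and such that a class which is sent to $\varphi$ corresponds under 1 to the complement $\{\,k\cdot i_*(\varphi(\pi_*(k))) : k\in K_0\,\}$. -/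

import Mathlib

open scoped Manifold ContDiff RightActions

universe uM uP uG uH

/-- `π : P → M` is a smooth (right) principal fibre bundle with structure group the Lie group `G`.
Here `m`, `k`, `n` are the dimensions of `M`, `G`, `P`, and `p <• g` is the right action of
`g : G` on `p : P`, i.e. `MulOpposite.op g • p`. -/
structure IsPrincipalBundle (m k n : ℕ) {M : Type uM} {P : Type uP} (G : Type uG)
    [TopologicalSpace M] [ChartedSpace (EuclideanSpace ℝ (Fin m)) M]
    [TopologicalSpace P] [ChartedSpace (EuclideanSpace ℝ (Fin n)) P]
    [TopologicalSpace G] [ChartedSpace (EuclideanSpace ℝ (Fin k)) G] [Group G]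
    [MulAction Gᵐᵒᵖ P] (π : P → M) : Prop where
  contMDiff_proj : ContMDiff (𝓡 n) (𝓡 m) ∞ π
  surjective_proj : Function.Surjective π
  contMDiff_action : ContMDiff ((𝓡 n).prod (𝓡 k)) (𝓡 n) ∞ (fun x : P × G => x.1 <• x.2)
  /-- The action preserves the fibres. -/
  proj_smul : ∀ (p : P) (g : G), π (p <• g) = π p
  /-- The action is transitive on fibres. -/
  transitive : ∀ p q : P, π p = π q → ∃ g : G, p <• g = q
  /-- The action is free. -/
  free : ∀ (p : P) (g : G), p <• g = p → g = 1
  /-- Near every point there is a smooth, `G`-equivariant local trivialisation. -/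
  locally_trivial : ∀ x : M, ∃ e : Bundle.Trivialization G π, x ∈ e.baseSet ∧
    ContMDiffOn (𝓡 n) ((𝓡 m).prod (𝓡 k)) ∞ e e.source ∧
    ContMDiffOn ((𝓡 m).prod (𝓡 k)) (𝓡 n) ∞ e.toOpenPartialHomeomorph.symm e.target ∧
    ∀ p ∈ e.source, ∀ g : G, (e (p <• g)).2 = (e p).2 * g

/-- `ρ : G' → G` exhibits the Lie group `G'` as a universal covering group of `G`: `G'` is simply
connected, and `ρ` is a homomorphism and a smooth covering map. -/
structure IsUniversalCoveringGroup (k : ℕ) {G : Type uG} {G' : Type uH}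
    [TopologicalSpace G] [ChartedSpace (EuclideanSpace ℝ (Fin k)) G] [Group G]
    [TopologicalSpace G'] [ChartedSpace (EuclideanSpace ℝ (Fin k)) G'] [Group G']
    (ρ : G' →* G) : Prop where
  simplyConnected : SimplyConnectedSpace G'
  isCoveringMap : IsCoveringMap ρ
  isLocalDiffeomorph : IsLocalDiffeomorph (𝓡 k) (𝓡 k) ∞ ρ

/-- A spinor structure for `π : P → M` relative to `ρ : G' → G`: a principal `G'`-bundle `Q` over
`M` together with a smooth bundle morphism `Q → P` over the identity of `M` that is equivariant
relative to `ρ`. (The dimension of `Q` is necessarily that of `P`.) -/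
structure SpinorStructure (m k n : ℕ) {M : Type uM} {P : Type uP} {G : Type uG} {G' : Type uH}
    [TopologicalSpace M] [ChartedSpace (EuclideanSpace ℝ (Fin m)) M]
    [TopologicalSpace P] [ChartedSpace (EuclideanSpace ℝ (Fin n)) P]
    [Group G] [MulAction Gᵐᵒᵖ P]
    [TopologicalSpace G'] [ChartedSpace (EuclideanSpace ℝ (Fin k)) G'] [Group G']
    (ρ : G' →* G) (π : P → M) where
  /-- The total space. -/
  Q : Type uP
  [topologicalSpace : TopologicalSpace Q]
  [t2Space : T2Space Q]
  [secondCountable : SecondCountableTopology Q]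
  [chartedSpace : ChartedSpace (EuclideanSpace ℝ (Fin n)) Q]
  [isManifold : IsManifold (𝓡 n) ∞ Q]
  [mulAction : MulAction G'ᵐᵒᵖ Q]
  /-- The bundle projection. -/
  proj : Q → M
  isPrincipalBundle : IsPrincipalBundle m k n G' proj
  /-- The spinor map. -/
  spinorMap : Q → P
  contMDiff_spinorMap : ContMDiff (𝓡 n) (𝓡 n) ∞ spinorMap
  spinorMap_smul : ∀ (q : Q) (g : G'), spinorMap (q <• g) = spinorMap q <• ρ g
  proj_spinorMap : ∀ q : Q, π (spinorMap q) = proj q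

attribute [instance] SpinorStructure.topologicalSpace SpinorStructure.t2Space
  SpinorStructure.secondCountable SpinorStructure.chartedSpace SpinorStructure.isManifold
  SpinorStructure.mulAction

namespace SpinorStructure

variable {m k n : ℕ} {M : Type uM} {P : Type uP} {G : Type uG} {G' : Type uH}
  [TopologicalSpace M] [ChartedSpace (EuclideanSpace ℝ (Fin m)) M]
  [TopologicalSpace P] [ChartedSpace (EuclideanSpace ℝ (Fin n)) P]
  [Group G] [MulAction Gᵐᵒᵖ P]
  [TopologicalSpace G'] [ChartedSpace (EuclideanSpace ℝ (Fin k)) G'] [Group G']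
  {ρ : G' →* G} {π : P → M}

/-- Two spinor structures are equivalent if there is a principal bundle morphism (over the identity
of `M`) between them that is compatible with the spinor maps. -/
def Equivalent (S T : SpinorStructure m k n ρ π) : Prop :=
  ∃ a : S.Q → T.Q, ContMDiff (𝓡 n) (𝓡 n) ∞ a ∧
    (∀ (q : S.Q) (g : G'), a (q <• g) = a q <• g) ∧
    (∀ q : S.Q, T.proj (a q) = S.proj q) ∧
    ∀ q : S.Q, T.spinorMap (a q) = S.spinorMap q

/-- The subgroup `u_*(π₁(Q, q₀))` of `π₁(P, p₀)`, where `u` is the spinor map and `u q₀ = p₀`. -/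
noncomputable def imageSubgroup (S : SpinorStructure m k n ρ π) {p₀ : P} (q₀ : S.Q)
    (hq₀ : S.spinorMap q₀ = p₀) : Subgroup (FundamentalGroup P p₀) :=
  (FundamentalGroup.mapOfEq ⟨S.spinorMap, S.contMDiff_spinorMap.continuous⟩ hq₀).range

end SpinorStructure

/-- The equivalence classes of spinor structures. -/
def SpinorClass (m k n : ℕ) {M : Type uM} {P : Type uP} {G : Type uG} {G' : Type uH}
    [TopologicalSpace M] [ChartedSpace (EuclideanSpace ℝ (Fin m)) M]
    [TopologicalSpace P] [ChartedSpace (EuclideanSpace ℝ (Fin n)) P]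
    [Group G] [MulAction Gᵐᵒᵖ P]
    [TopologicalSpace G'] [ChartedSpace (EuclideanSpace ℝ (Fin k)) G'] [Group G']
    (ρ : G' →* G) (π : P → M) :=
  Quot (SpinorStructure.Equivalent (m := m) (k := k) (n := n) (ρ := ρ) (π := π))

/-- The equivalence class of a spinor structure. -/
def SpinorStructure.toClass {m k n : ℕ} {M : Type uM} {P : Type uP} {G : Type uG} {G' : Type uH}
    [TopologicalSpace M] [ChartedSpace (EuclideanSpace ℝ (Fin m)) M]
    [TopologicalSpace P] [ChartedSpace (EuclideanSpace ℝ (Fin n)) P]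
    [Group G] [MulAction Gᵐᵒᵖ P]
    [TopologicalSpace G'] [ChartedSpace (EuclideanSpace ℝ (Fin k)) G'] [Group G']
    {ρ : G' →* G} {π : P → M} (S : SpinorStructure m k n ρ π) : SpinorClass m k n ρ π :=
  Quot.mk _ S

namespace IsPrincipalBundle

variable {m k n : ℕ} {M : Type uM} {P : Type uP} {G : Type uG}
  [TopologicalSpace M] [ChartedSpace (EuclideanSpace ℝ (Fin m)) M]
  [TopologicalSpace P] [ChartedSpace (EuclideanSpace ℝ (Fin n)) P]
  [TopologicalSpace G] [ChartedSpace (EuclideanSpace ℝ (Fin k)) G] [Group G]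
  [MulAction Gᵐᵒᵖ P] {π : P → M}

/-- The orbit map `i : G → P`, `i g = p₀ g`. -/
def orbitMap (h : IsPrincipalBundle m k n G π) (p₀ : P) : C(G, P) where
  toFun g := p₀ <• g
  continuous_toFun := h.contMDiff_action.continuous.comp (Continuous.prodMk_right p₀)

/-- The homomorphism `i_* : π₁(G, 1) → π₁(P, p₀)`. -/
noncomputable def orbitMapStar (h : IsPrincipalBundle m k n G π) (p₀ : P) :
    FundamentalGroup G (1 : G) →* FundamentalGroup P p₀ :=
  FundamentalGroup.mapOfEq (h.orbitMap p₀) (one_smul Gᵐᵒᵖ p₀)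

/-- The homomorphism `π_* : π₁(P, p₀) → π₁(M, π p₀)`. -/
noncomputable def projStar (h : IsPrincipalBundle m k n G π) (p₀ : P) :
    FundamentalGroup P p₀ →* FundamentalGroup M (π p₀) :=
  FundamentalGroup.mapOfEq ⟨π, h.contMDiff_proj.continuous⟩ rfl

/-- `π₁(P, p₀)` is the internal direct product of `K` and `i_*(π₁(G, 1))`, and `π_*` maps `K`
isomorphically onto `π₁(M, π p₀)`. -/
structure IsComplement (h : IsPrincipalBundle m k n G π) (p₀ : P)
    (K : Subgroup (FundamentalGroup P p₀)) : Prop where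
  commute : ∀ x ∈ K, ∀ y ∈ (h.orbitMapStar p₀).range, Commute x y
  inf_eq_bot : K ⊓ (h.orbitMapStar p₀).range = ⊥
  sup_eq_top : K ⊔ (h.orbitMapStar p₀).range = ⊤
  bijOn_projStar : Set.BijOn (h.projStar p₀) K Set.univ

/-- The conditions of the existence theorem: `i_*` is an isomorphism onto its image, and this image
has a complement `K` as in `IsComplement`. -/
def ExistenceCondition (h : IsPrincipalBundle m k n G π) (p₀ : P) : Prop :=
  Function.Injective (h.orbitMapStar p₀) ∧ ∃ K, h.IsComplement p₀ K

end IsPrincipalBundle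

/-! The proof combines covering space theory with a little group theory. Multiplying a loop in P
pointwise by a loop in G represents the product of the two classes in either order, so i_*(π₁(G)) is
central in π₁(P). Existence of one complement forces ker π_* = i_*(π₁(G)). A subgroup is then a
complement exactly when π_* maps it bijectively onto π₁(M) (`isComplement_iff`), and two nested
complements are equal.

A spinor map u : Q → P is, in suitable local trivialisations, the map ρ on fibres. It is therefore a
local diffeomorphism and a covering, the quotient by ker ρ (`isCoveringMap_of_equivariant`). A loop
of P lies in u_*(π₁(Q)) if and only if its lift closes up. The lift of p₀g is q₀g̃, where g̃ is the
lift of g to the universal covering group. This closes only if g is null-homotopic, so u_*(π₁(Q))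
meets i_*(π₁(G)) trivially. A lift that fails to close is corrected by a path in the covering group,
which does not change the projection to M. Hence u_*(π₁(Q)) is a complement. The lifting criterion
recovers Q up to equivalence from this subgroup (`equivalent_of_imageSubgroup_eq`).

Conversely, given a complement K, take the connected covering E → P belonging to K. Simple
connectedness of the covering group lets its action lift to E. Triviality of K ∩ i_*(π₁(G)), with
injectivity of i_*, makes the action free; K · i_*(π₁(G)) = π₁(P) makes it transitive on fibres over
M. With charts pulled back from P, E is a spinor structure (`exists_imageSubgroup_eq`).

Part 2 is algebra: complements are graphs over K₀ of homomorphisms into a central subgroup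
(`homEquivComplement`). -/

section Complements

/-! ### Complements of a central subgroup. -/

variable {A B C : Type*} [Group A] [Group B] [Group C]

/-- Twisting by `φ`: the endomorphism `y ↦ y * i (φ (p y))` for a central homomorphism `i`. -/
def MonoidHom.centralTwist (i : A →* B) (p : B →* C) (hc : ∀ x a, Commute x (i a))
    (φ : C →* A) : B →* B where
  toFun y := y * i (φ (p y))
  map_one' := by simp
  map_mul' x y := by
    have h := (hc y (φ (p x))).eq
    simp only [map_mul, mul_assoc]
    rw [← mul_assoc y (i _), h, mul_assoc]

variable {i : A →* B} {p : B →* C}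

theorem MonoidHom.normal_range_of_commute (hc : ∀ x a, Commute x (i a)) : i.range.Normal :=
  ⟨by
    rintro _ ⟨a, rfl⟩ g
    rw [(hc g a).eq]
    simp⟩

theorem Subgroup.injOn_of_inf_range_eq_bot {K : Subgroup B} (hker : p.ker = i.range)
    (h : K ⊓ i.range = ⊥) : Set.InjOn p K := by
  intro x hx y hy hxy
  have : x * y⁻¹ ∈ K ⊓ i.range := by
    refine ⟨K.mul_mem hx (K.inv_mem hy), ?_⟩
    have : x * y⁻¹ ∈ p.ker := by simp [MonoidHom.mem_ker, hxy]
    rwa [hker] at this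
  rw [h, Subgroup.mem_bot] at this
  exact mul_inv_eq_one.1 this

theorem Subgroup.inf_range_eq_bot_of_bijOn {K : Subgroup B} (hker : p.ker = i.range)
    (h : Set.BijOn p K Set.univ) : K ⊓ i.range = ⊥ := by
  rw [eq_bot_iff]
  rintro x ⟨hx, hx'⟩
  have hx' : x ∈ p.ker := hker ▸ hx'
  exact h.injOn hx K.one_mem (by rw [MonoidHom.mem_ker.1 hx', map_one])

theorem Subgroup.sup_range_eq_top_of_bijOn {K : Subgroup B} (hker : p.ker = i.range)
    (h : Set.BijOn p K Set.univ) : K ⊔ i.range = ⊤ := by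
  rw [eq_top_iff]
  intro x _
  obtain ⟨k, hk, hkx⟩ := h.surjOn (Set.mem_univ (p x))
  have : k⁻¹ * x ∈ i.range := by
    rw [← hker, MonoidHom.mem_ker]
    simp [hkx]
  simpa using mul_mem_sup hk this

/-- Exactness in the middle comes from the complement itself, so the long exact homotopy sequence of
the bundle is not needed. -/
theorem Subgroup.ker_eq_range_of_complement {K : Subgroup B} (hpi : ∀ a, p (i a) = 1)
    (hc : ∀ x a, Commute x (i a)) (hsup : K ⊔ i.range = ⊤) (h : Set.BijOn p K Set.univ) :
    p.ker = i.range := by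
  apply le_antisymm
  · intro x hx
    have := MonoidHom.normal_range_of_commute hc
    have : x ∈ K ⊔ i.range := hsup ▸ Subgroup.mem_top x
    obtain ⟨k, hk, _, ⟨a, rfl⟩, rfl⟩ := Subgroup.mem_sup_of_normal_right.1 this
    rw [MonoidHom.mem_ker, map_mul, hpi, mul_one] at hx
    have : k = 1 := h.injOn hk K.one_mem (by rw [hx, map_one])
    simp [this]
  · rintro _ ⟨a, rfl⟩
    exact hpi a

theorem Subgroup.bijOn_map_centralTwist {K : Subgroup B} (hpi : ∀ a, p (i a) = 1)
    (hc : ∀ x a, Commute x (i a)) (h : Set.BijOn p K Set.univ) (φ : C →* A) :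
    Set.BijOn p (K.map (i.centralTwist p hc φ)) Set.univ := by
  have hp : ∀ y, p (i.centralTwist p hc φ y) = p y := fun y => by
    simp [MonoidHom.centralTwist, hpi]
  refine ⟨fun _ _ => Set.mem_univ _, ?_, ?_⟩
  · rintro _ ⟨y, hy, rfl⟩ _ ⟨z, hz, rfl⟩ hyz
    rw [hp, hp] at hyz
    rw [h.injOn hy hz hyz]
  · intro c hc'
    obtain ⟨y, hy, rfl⟩ := h.surjOn hc'
    exact ⟨_, ⟨y, hy, rfl⟩, hp y⟩

theorem Subgroup.map_centralTwist_injective {K : Subgroup B} (hi : Function.Injective i)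
    (hpi : ∀ a, p (i a) = 1) (hc : ∀ x a, Commute x (i a)) (h : Set.BijOn p K Set.univ) :
    Function.Injective fun φ : C →* A => K.map (i.centralTwist p hc φ) := by
  intro φ ψ hφψ
  ext c
  obtain ⟨y, hy, rfl⟩ := h.surjOn (Set.mem_univ c)
  have : i.centralTwist p hc φ y ∈ K.map (i.centralTwist p hc ψ) := by
    rw [← show K.map (i.centralTwist p hc φ) = K.map (i.centralTwist p hc ψ) from hφψ]
    exact ⟨y, hy, rfl⟩
  obtain ⟨z, hz, hzy⟩ := this
  have hzy : z * i (ψ (p z)) = y * i (φ (p y)) := hzy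
  have hp := congrArg p hzy
  simp only [map_mul, hpi, mul_one] at hp
  obtain rfl := h.injOn hz hy hp
  exact (hi (mul_left_cancel hzy)).symm

/-- The inverses s and t of p on K and K' are homomorphisms. They differ by an element of the
kernel, and centrality makes the difference s⁻¹t multiplicative. -/
theorem Subgroup.exists_map_centralTwist_eq {K K' : Subgroup B} (hi : Function.Injective i)
    (hker : p.ker = i.range) (hc : ∀ x a, Commute x (i a)) (h : Set.BijOn p K Set.univ)
    (h' : Set.BijOn p K' Set.univ) :
    ∃ φ : C →* A, K.map (i.centralTwist p hc φ) = K' := by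
  choose s hsK hs using fun c => h.surjOn (Set.mem_univ c)
  choose t htK ht using fun c => h'.surjOn (Set.mem_univ c)
  have hst : ∀ c, ∃ a, i a = (s c)⁻¹ * t c := fun c => by
    have : (s c)⁻¹ * t c ∈ p.ker := by simp [MonoidHom.mem_ker, hs, ht]
    rwa [hker] at this
  choose f hf using hst
  have hsmul : ∀ c d, s (c * d) = s c * s d := fun c d =>
    h.injOn (hsK _) (K.mul_mem (hsK _) (hsK _)) (by simp [hs])
  have htmul : ∀ c d, t (c * d) = t c * t d := fun c d =>
    h'.injOn (htK _) (K'.mul_mem (htK _) (htK _)) (by simp [ht])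
  have hfmul : ∀ c d, f (c * d) = f c * f d := fun c d => hi <| by
    rw [hf, map_mul, hsmul, htmul, hf d, mul_inv_rev, mul_assoc, ← mul_assoc _ (t c), ← hf c,
      ← mul_assoc, ← mul_assoc, (hc _ _).eq]
  refine ⟨MonoidHom.mk' f hfmul, ?_⟩
  have key : ∀ y ∈ K, i.centralTwist p hc (MonoidHom.mk' f hfmul) y = t (p y) := fun y hy => by
    change y * i (f (p y)) = _
    rw [hf, h.injOn (hsK (p y)) hy (hs _)]
    simp
  ext x
  constructor
  · rintro ⟨y, hy, rfl⟩
    rw [key y hy]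
    exact htK _
  · intro hx
    refine ⟨s (p x), hsK _, ?_⟩
    rw [key _ (hsK _), hs]
    exact h'.injOn (htK _) hx (ht _)

end Complements

/-! ### Loops and their lifts through coverings. -/

section FundamentalGroup

variable {X Y : Type*} [TopologicalSpace X] [TopologicalSpace Y]

namespace FundamentalGroup

/-- The class of a loop in the fundamental group. -/
def ofLoop {x : X} (γ : Path x x) : FundamentalGroup X x := Path.Homotopic.Quotient.mk γ

theorem ofLoop_surjective {x : X} (a : FundamentalGroup X x) : ∃ γ : Path x x, ofLoop γ = a :=
  Path.Homotopic.Quotient.mk_surjective a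

theorem ofLoop_eq_iff {x : X} {γ δ : Path x x} : ofLoop γ = ofLoop δ ↔ γ.Homotopic δ :=
  Path.Homotopic.Quotient.eq

/-- Multiplication composes loops from right to left; this fixes the order of factors everywhere
below. -/
theorem ofLoop_mul {x : X} (γ δ : Path x x) : ofLoop γ * ofLoop δ = ofLoop (δ.trans γ) := rfl

theorem mapOfEq_ofLoop (f : C(X, Y)) {x : X} {y : Y} (h : f x = y) (γ : Path x x) :
    mapOfEq f h (ofLoop γ) = ofLoop ((γ.map f.continuous).cast h.symm h.symm) := by
  rw [mapOfEq_apply]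
  rfl

end FundamentalGroup

open FundamentalGroup in
-- Homotopic loops have lifts with the same endpoint. Every later question about an image subgroup
-- is turned by this lemma into one about the endpoint of a lifted path.
theorem IsCoveringMap.ofLoop_mem_range_mapOfEq_iff {p : X → Y} (cov : IsCoveringMap p) {x x' : X}
    {y : Y} (h : p x = y) (γ : Path y y) (Γ : Path x x') (hΓ : ∀ t, p (Γ t) = γ t) :
    ofLoop γ ∈ (mapOfEq ⟨p, cov.continuous⟩ h).range ↔ x' = x := by
  constructor
  · rintro ⟨a, ha⟩
    obtain ⟨Δ, rfl⟩ := ofLoop_surjective a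
    rw [mapOfEq_ofLoop, ofLoop_eq_iff] at ha
    subst h
    have := cov.liftPath_apply_one_eq_of_homotopicRel ha x (by simp) (by simp)
    rw [← (cov.eq_liftPath_iff' (Γ := (Δ : C(unitInterval, X))) _).2 ⟨rfl, Δ.source⟩,
      ← (cov.eq_liftPath_iff' (Γ := (Γ : C(unitInterval, X))) _).2 ⟨funext hΓ, Γ.source⟩] at this
    simpa using this.symm
  · rintro rfl
    refine ⟨ofLoop Γ, ?_⟩
    rw [mapOfEq_ofLoop]
    congr 1
    ext t
    exact hΓ t

end FundamentalGroup

/-! ### Centrality of the image of π₁(G), and the complements in π₁(P). -/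

namespace IsPrincipalBundle

open FundamentalGroup

variable {m k n : ℕ} {M : Type uM} {P : Type uP} {G : Type uG}
  [TopologicalSpace M] [ChartedSpace (EuclideanSpace ℝ (Fin m)) M]
  [TopologicalSpace P] [ChartedSpace (EuclideanSpace ℝ (Fin n)) P]
  [TopologicalSpace G] [ChartedSpace (EuclideanSpace ℝ (Fin k)) G] [Group G]
  [MulAction Gᵐᵒᵖ P] {π : P → M} (h : IsPrincipalBundle m k n G π)

/-- The action `P × G → P` as a continuous map. -/
def actionMap : C(P × G, P) := ⟨fun x => x.1 <• x.2, h.contMDiff_action.continuous⟩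

/-- The pointwise product of a loop in `P` with a loop in `G`. -/
def smulLoop {p₀ : P} (γ : Path p₀ p₀) (g : Path (1 : G) 1) : Path p₀ p₀ :=
  ((γ.prod g).map h.actionMap.continuous).cast (one_smul Gᵐᵒᵖ p₀).symm (one_smul Gᵐᵒᵖ p₀).symm

theorem smulLoop_apply {p₀ : P} (γ : Path p₀ p₀) (g : Path (1 : G) 1) (t : unitInterval) :
    h.smulLoop γ g t = γ t <• g t := rfl

theorem orbitMapStar_ofLoop (p₀ : P) (g : Path (1 : G) 1) :
    h.orbitMapStar p₀ (ofLoop g) = ofLoop (h.smulLoop (Path.refl p₀) g) :=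
  mapOfEq_ofLoop (h.orbitMap p₀) (one_smul Gᵐᵒᵖ p₀) g

theorem ofLoop_smulLoop_eq_mapOfEq {p₀ : P} (γ : Path p₀ p₀) (g : Path (1 : G) 1) :
    ofLoop (h.smulLoop γ g) =
      mapOfEq (x := (p₀, (1 : G))) h.actionMap (one_smul Gᵐᵒᵖ p₀) (ofLoop (γ.prod g)) :=
  (mapOfEq_ofLoop (x := (p₀, (1 : G))) h.actionMap (one_smul Gᵐᵒᵖ p₀) _).symm

theorem smulLoop_refl {p₀ : P} (γ : Path p₀ p₀) : h.smulLoop γ (Path.refl (1 : G)) = γ := by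
  ext t
  exact one_smul Gᵐᵒᵖ _

/-- Eckmann–Hilton: in P × G the loop (γ, g) is homotopic to (1, g) followed by (γ, 1), and also to
these in the opposite order. Pushing both homotopies through the action gives this lemma and its
mirror image, hence centrality. -/
theorem ofLoop_smulLoop {p₀ : P} (γ : Path p₀ p₀) (g : Path (1 : G) 1) :
    ofLoop (h.smulLoop γ g) = ofLoop γ * h.orbitMapStar p₀ (ofLoop g) := by
  rw [orbitMapStar_ofLoop, ← congrArg ofLoop (h.smulLoop_refl γ)]
  simp only [ofLoop_smulLoop_eq_mapOfEq]
  rw [← map_mul, ofLoop_mul, Path.trans_prod_eq_prod_trans]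
  congr 1
  exact ofLoop_eq_iff.2 ⟨Path.Homotopic.prodHomotopy
    (Path.Homotopy.reflTrans γ).symm (Path.Homotopy.transRefl g).symm⟩

theorem ofLoop_smulLoop' {p₀ : P} (γ : Path p₀ p₀) (g : Path (1 : G) 1) :
    ofLoop (h.smulLoop γ g) = h.orbitMapStar p₀ (ofLoop g) * ofLoop γ := by
  rw [orbitMapStar_ofLoop, ← congrArg ofLoop (h.smulLoop_refl γ)]
  simp only [ofLoop_smulLoop_eq_mapOfEq]
  rw [← map_mul, ofLoop_mul, Path.trans_prod_eq_prod_trans]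
  congr 1
  exact ofLoop_eq_iff.2 ⟨Path.Homotopic.prodHomotopy
    (Path.Homotopy.transRefl γ).symm (Path.Homotopy.reflTrans g).symm⟩

theorem commute_orbitMapStar (p₀ : P) (x : FundamentalGroup P p₀) (y : FundamentalGroup G (1 : G)) :
    Commute x (h.orbitMapStar p₀ y) := by
  obtain ⟨γ, rfl⟩ := ofLoop_surjective x
  obtain ⟨g, rfl⟩ := ofLoop_surjective y
  exact (h.ofLoop_smulLoop γ g).symm.trans (h.ofLoop_smulLoop' γ g)

theorem projStar_smulLoop {p₀ : P} (γ : Path p₀ p₀) (g : Path (1 : G) 1) :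
    h.projStar p₀ (ofLoop (h.smulLoop γ g)) = h.projStar p₀ (ofLoop γ) := by
  rw [projStar, mapOfEq_ofLoop, mapOfEq_ofLoop]
  congr 1
  ext t
  exact h.proj_smul _ _

theorem projStar_orbitMapStar (p₀ : P) (y : FundamentalGroup G (1 : G)) :
    h.projStar p₀ (h.orbitMapStar p₀ y) = 1 := by
  obtain ⟨g, rfl⟩ := ofLoop_surjective y
  rw [orbitMapStar_ofLoop, projStar_smulLoop]
  exact map_one (h.projStar p₀)

theorem ker_projStar {p₀ : P} (hex : h.ExistenceCondition p₀) :
    (h.projStar p₀).ker = (h.orbitMapStar p₀).range := by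
  obtain ⟨-, K, hK⟩ := hex
  exact Subgroup.ker_eq_range_of_complement (h.projStar_orbitMapStar p₀)
    (h.commute_orbitMapStar p₀) hK.sup_eq_top hK.bijOn_projStar

theorem isComplement_iff {p₀ : P} (hex : h.ExistenceCondition p₀)
    (K : Subgroup (FundamentalGroup P p₀)) :
    h.IsComplement p₀ K ↔ Set.BijOn (h.projStar p₀) K Set.univ := by
  refine ⟨fun hK => hK.bijOn_projStar, fun hK => ⟨?_, ?_, ?_, hK⟩⟩
  · rintro x - _ ⟨y, rfl⟩
    exact h.commute_orbitMapStar p₀ x y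
  · exact Subgroup.inf_range_eq_bot_of_bijOn (h.ker_projStar hex) hK
  · exact Subgroup.sup_range_eq_top_of_bijOn (h.ker_projStar hex) hK

/-- Relative to a fixed complement `K₀`, the homomorphisms `π₁(M) → π₁(G)` parametrise the
complements. -/
noncomputable def homEquivComplement {p₀ : P} (hex : h.ExistenceCondition p₀)
    {K₀ : Subgroup (FundamentalGroup P p₀)} (hK₀ : h.IsComplement p₀ K₀) :
    (FundamentalGroup M (π p₀) →* FundamentalGroup G (1 : G)) ≃
      {K : Subgroup (FundamentalGroup P p₀) // h.IsComplement p₀ K} :=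
  Equiv.ofBijective (fun φ => ⟨K₀.map ((h.orbitMapStar p₀).centralTwist (h.projStar p₀)
      (h.commute_orbitMapStar p₀) φ), (h.isComplement_iff hex _).2 <|
        Subgroup.bijOn_map_centralTwist (h.projStar_orbitMapStar p₀) _ hK₀.bijOn_projStar φ⟩)
    ⟨fun _ _ hφψ => Subgroup.map_centralTwist_injective hex.1 (h.projStar_orbitMapStar p₀)
      (h.commute_orbitMapStar p₀) hK₀.bijOn_projStar (congrArg Subtype.val hφψ),
    fun K => by
      obtain ⟨φ, hφ⟩ := Subgroup.exists_map_centralTwist_eq hex.1 (h.ker_projStar hex)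
        (h.commute_orbitMapStar p₀) hK₀.bijOn_projStar K.2.bijOn_projStar
      exact ⟨φ, Subtype.ext hφ⟩⟩

theorem mem_homEquivComplement {p₀ : P} (hex : h.ExistenceCondition p₀)
    {K₀ : Subgroup (FundamentalGroup P p₀)} (hK₀ : h.IsComplement p₀ K₀)
    (φ : FundamentalGroup M (π p₀) →* FundamentalGroup G (1 : G)) (x : FundamentalGroup P p₀) :
    x ∈ (h.homEquivComplement hex hK₀ φ : Subgroup (FundamentalGroup P p₀)) ↔
      ∃ y ∈ K₀, x = y * h.orbitMapStar p₀ (φ (h.projStar p₀ y)) :=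
  ⟨fun ⟨y, hy, hxy⟩ => ⟨y, hy, hxy.symm⟩, fun ⟨y, hy, hxy⟩ => ⟨y, hy, hxy.symm⟩⟩

theorem homEquivComplement_one {p₀ : P} (hex : h.ExistenceCondition p₀)
    {K₀ : Subgroup (FundamentalGroup P p₀)} (hK₀ : h.IsComplement p₀ K₀) :
    h.homEquivComplement hex hK₀ 1 = ⟨K₀, hK₀⟩ := by
  ext x
  rw [mem_homEquivComplement]
  simp only [MonoidHom.one_apply, map_one, mul_one, exists_eq_right']

/-! ### Topology of principal bundles -/

theorem isOpenMap_proj (h : IsPrincipalBundle m k n G π) : IsOpenMap π := by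
  rw [isOpenMap_iff_nhds_le]
  intro p
  obtain ⟨e, he, -⟩ := h.locally_trivial (π p)
  exact (e.map_proj_nhds (e.mem_source.2 he)).ge

theorem connectedSpace [ConnectedSpace M] [ConnectedSpace G]
    (h : IsPrincipalBundle m k n G π) : ConnectedSpace P := by
  have hne : Nonempty P := ⟨(h.surjective_proj (Classical.arbitrary M)).choose⟩
  refine { toPreconnectedSpace := preconnectedSpace_iff_clopen.2 fun s hs => ?_, toNonempty := hne }
  -- Fibres are orbits of the connected group G, so clopen sets are unions of fibres and their
  -- images in M are clopen.
  have hsat : ∀ s : Set P, IsClopen s → ∀ p ∈ s, ∀ q, π p = π q → q ∈ s := by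
    intro s hs p hp q hpq
    obtain ⟨g, rfl⟩ := h.transitive p q hpq
    have : IsClopen (h.orbitMap p ⁻¹' s) := hs.preimage (h.orbitMap p).continuous
    have huniv : h.orbitMap p ⁻¹' s = Set.univ :=
      this.eq_univ ⟨1, by simpa [orbitMap] using hp⟩
    exact (huniv ▸ Set.mem_univ g : g ∈ h.orbitMap p ⁻¹' s)
  have himage : IsClopen (π '' s) := by
    refine ⟨⟨?_⟩, h.isOpenMap_proj _ hs.isOpen⟩
    have : (π '' s)ᶜ = π '' sᶜ := by
      ext x
      constructor
      · intro hx
        obtain ⟨p, rfl⟩ := h.surjective_proj x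
        exact ⟨p, fun hp => hx ⟨p, hp, rfl⟩, rfl⟩
      · rintro ⟨p, hp, rfl⟩ ⟨q, hq, hqp⟩
        exact hp (hsat s hs q hq p hqp)
    rw [this]
    exact h.isOpenMap_proj _ hs.compl.isOpen
  rcases isClopen_iff.1 himage with h0 | h1
  · exact Or.inl (Set.image_eq_empty.1 h0)
  · refine Or.inr (Set.eq_univ_of_forall fun p => ?_)
    obtain ⟨q, hq, hqp⟩ := (h1 ▸ Set.mem_univ (π p) : π p ∈ π '' s)
    exact hsat s hs q hq p hqp

end IsPrincipalBundle

/-! ### Local diffeomorphisms. -/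

section LocalDiffeomorph

open scoped Topology

variable {𝕜 : Type*} [NontriviallyNormedField 𝕜]
  {E : Type*} [NormedAddCommGroup E] [NormedSpace 𝕜 E] {H : Type*} [TopologicalSpace H]
  {I : ModelWithCorners 𝕜 E H} {X : Type*} [TopologicalSpace X] [ChartedSpace H X]
  {E' : Type*} [NormedAddCommGroup E'] [NormedSpace 𝕜 E'] {H' : Type*} [TopologicalSpace H']
  {J : ModelWithCorners 𝕜 E' H'} {Y : Type*} [TopologicalSpace Y] [ChartedSpace H' Y]
  {E'' : Type*} [NormedAddCommGroup E''] [NormedSpace 𝕜 E''] {H'' : Type*} [TopologicalSpace H'']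
  {L : ModelWithCorners 𝕜 E'' H''} {Z : Type*} [TopologicalSpace Z] [ChartedSpace H'' Z]
  {r : WithTop ℕ∞}

theorem IsLocalDiffeomorphAt.of_localInverse {f : X → Y} {g : Y → X} {x : X} {A : Set X} {B : Set Y}
    (hA : IsOpen A) (hB : IsOpen B) (hxA : x ∈ A) (hxB : f x ∈ B) (hf : ContMDiffOn I J r f A)
    (hg : ContMDiffOn J I r g B) (hgf : ∀ a ∈ A, f a ∈ B → g (f a) = a)
    (hfg : ∀ b ∈ B, f (g b) = b) :
    IsLocalDiffeomorphAt I J r f x :=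
  ⟨{ toFun := f
     invFun := g
     source := A ∩ f ⁻¹' B
     target := B ∩ g ⁻¹' A
     map_source' := fun a ha => ⟨ha.2, by simpa [hgf a ha.1 ha.2] using ha.1⟩
     map_target' := fun b hb => ⟨hb.2, by simpa [hfg b hb.1] using hb.1⟩
     left_inv' := fun a ha => hgf a ha.1 ha.2
     right_inv' := fun b hb => hfg b hb.1
     open_source := hf.continuousOn.isOpen_inter_preimage hA hB
     open_target := hg.continuousOn.isOpen_inter_preimage hB hA
     contMDiffOn_toFun := hf.mono Set.inter_subset_left
     contMDiffOn_invFun := hg.mono Set.inter_subset_left }, ⟨hxA, hxB⟩, fun _ _ => rfl⟩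

theorem IsLocalDiffeomorphAt.contMDiffAt_of_comp {u : X → Y} {f : Z → X} {z : Z}
    (hu : IsLocalDiffeomorphAt I J r u (f z)) (hf : ContinuousAt f z)
    (huf : ContMDiffAt L J r (fun w => u (f w)) z) : ContMDiffAt L I r f z := by
  have h1 : ContMDiffAt L I r (hu.localInverse ∘ fun w => u (f w)) z :=
    hu.localInverse_contMDiffAt.comp z huf
  refine h1.congr_of_eventuallyEq ?_
  filter_upwards [hf.eventually (hu.localInverse.open_target.mem_nhds hu.localInverse_mem_target)]
    with w hw
  exact (hu.localInverse_left_inv hw).symm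

theorem IsLocalDiffeomorph.contMDiff_of_comp {u : X → Y} {f : Z → X}
    (hu : IsLocalDiffeomorph I J r u) (hf : Continuous f)
    (huf : ContMDiff L J r (fun w => u (f w))) : ContMDiff L I r f :=
  fun z => (hu (f z)).contMDiffAt_of_comp hf.continuousAt (huf z)

end LocalDiffeomorph

theorem IsCoveringMap.surjective_of_connected {E X : Type*} [TopologicalSpace E]
    [TopologicalSpace X] [Nonempty E] [ConnectedSpace X] {p : E → X} (hp : IsCoveringMap p) :
    Function.Surjective p := by
  rw [← Set.range_eq_univ]
  refine IsClopen.eq_univ ⟨⟨?_⟩, hp.isOpenMap.isOpen_range⟩ (Set.range_nonempty p)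
  rw [isOpen_iff_mem_nhds]
  intro x hx
  -- Over U the covering is a product with the fibre over x. A point over any y in U therefore gives
  -- one over x, so the complement of the range is open.
  obtain ⟨-, U, hxU, hU, -, H, hH⟩ := hp x
  refine Filter.mem_of_superset (hU.mem_nhds hxU) ?_
  rintro _ hy ⟨e, rfl⟩
  exact hx ⟨(H ⟨e, hy⟩).2.1, (H ⟨e, hy⟩).2.2⟩

/-! ### Equivariant maps of principal bundles are coverings. -/

section EquivariantMap

open scoped Topology

variable {m k n : ℕ} {M : Type uM} {P : Type uP} {Q : Type*} {G : Type uG} {G' : Type uH}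
  [TopologicalSpace M] [ChartedSpace (EuclideanSpace ℝ (Fin m)) M]
  [TopologicalSpace P] [ChartedSpace (EuclideanSpace ℝ (Fin n)) P]
  [TopologicalSpace Q] [ChartedSpace (EuclideanSpace ℝ (Fin n)) Q]
  [TopologicalSpace G] [ChartedSpace (EuclideanSpace ℝ (Fin k)) G] [Group G]
  [TopologicalSpace G'] [ChartedSpace (EuclideanSpace ℝ (Fin k)) G'] [Group G']
  [MulAction Gᵐᵒᵖ P] [MulAction G'ᵐᵒᵖ Q] {π : P → M} {π' : Q → M} {ρ : G' →* G} {u : Q → P}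

namespace IsPrincipalBundle

theorem smul_left_cancel (h : IsPrincipalBundle m k n G π) {p : P} {a b : G}
    (hab : p <• a = p <• b) : a = b := by
  have := h.free p (a * b⁻¹) (by
    rw [MulOpposite.op_mul, mul_smul, hab, ← mul_smul, ← MulOpposite.op_mul]
    simp)
  exact mul_inv_eq_one.1 this

theorem contMDiffOn_smul (h : IsPrincipalBundle m k n G π) {H : Type*} [TopologicalSpace H]
    {V : Type*} [NormedAddCommGroup V] [NormedSpace ℝ V] {I : ModelWithCorners ℝ V H}
    {X : Type*} [TopologicalSpace X] [ChartedSpace H X] {f : X → P} {g : X → G} {s : Set X}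
    (hf : ContMDiffOn I (𝓡 n) ∞ f s) (hg : ContMDiffOn I (𝓡 k) ∞ g s) :
    ContMDiffOn I (𝓡 n) ∞ (fun x => f x <• g x) s :=
  h.contMDiff_action.comp_contMDiffOn (hf.prodMk hg)

/-- There is a smooth local section through every point. -/
theorem exists_localSection [LieGroup (𝓡 k) ∞ G] (h : IsPrincipalBundle m k n G π) (p : P) :
    ∃ (A : Set M) (s : M → P), IsOpen A ∧ π p ∈ A ∧ s (π p) = p ∧ ContMDiffOn (𝓡 m) (𝓡 n) ∞ s A ∧
      ∀ y ∈ A, π (s y) = y := by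
  obtain ⟨e, he, -, he', -⟩ := h.locally_trivial (π p)
  refine ⟨e.baseSet, fun y => e.toOpenPartialHomeomorph.symm (y, (e p).2), e.open_baseSet, he,
    ?_, ?_, ?_⟩
  · exact e.symm_apply_mk_proj (e.mem_source.2 he)
  · exact he'.comp (contMDiffOn_id.prodMk contMDiffOn_const) fun y hy => e.mem_target.2 hy
  · exact fun y hy => e.proj_symm_apply' hy

/-- The smooth function comparing points with a local section. -/
theorem exists_division [LieGroup (𝓡 k) ∞ G] (h : IsPrincipalBundle m k n G π) {A : Set M}
    (hA : IsOpen A) {s : M → P} (hs : ContMDiffOn (𝓡 m) (𝓡 n) ∞ s A)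
    (hπs : ∀ y ∈ A, π (s y) = y) {x : M} (hx : x ∈ A) :
    ∃ (B : Set M) (d : P → G), IsOpen B ∧ x ∈ B ∧ B ⊆ A ∧
      ContMDiffOn (𝓡 n) (𝓡 k) ∞ d (π ⁻¹' B) ∧ ∀ p, π p ∈ B → s (π p) <• d p = p := by
  obtain ⟨e, he, hes, -, heq⟩ := h.locally_trivial x
  have hmaps : Set.MapsTo π (π ⁻¹' (A ∩ e.baseSet)) A := fun p hp => hp.1
  have hsrc : ∀ p, π p ∈ A ∩ e.baseSet → s (π p) ∈ e.source := fun p hp => by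
    rw [e.mem_source, hπs _ hp.1]
    exact hp.2
  refine ⟨A ∩ e.baseSet, fun p => (e (s (π p))).2⁻¹ * (e p).2, hA.inter e.open_baseSet, ⟨hx, he⟩,
    Set.inter_subset_left, ?_, ?_⟩
  · refine ContMDiffOn.mul (ContMDiffOn.inv ?_) ?_
    · exact contMDiff_snd.comp_contMDiffOn
        (hes.comp (hs.comp h.contMDiff_proj.contMDiffOn hmaps) hsrc)
    · exact contMDiff_snd.comp_contMDiffOn (hes.mono fun p hp => e.mem_source.2 hp.2)
  · intro p hp
    have hp' : p ∈ e.source := e.mem_source.2 hp.2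
    have h1 := hsrc p hp
    refine e.injOn (e.mem_source.2 ?_) hp' (Prod.ext ?_ ?_)
    · rw [h.proj_smul]
      exact e.mem_source.1 h1
    · change (e _).1 = (e _).1
      rw [e.coe_fst' (by rw [h.proj_smul]; exact e.mem_source.1 h1), e.coe_fst hp', h.proj_smul,
        hπs _ hp.1]
    · change (e _).2 = (e _).2
      rw [heq _ h1]
      simp

/-- Measured against a local section s of Q and the section u ∘ s of P, the map u becomes ρ. Since s
passes through q, a local inverse of ρ at 1 suffices to invert u near q. -/
theorem isLocalDiffeomorph_of_equivariant [LieGroup (𝓡 k) ∞ G] [LieGroup (𝓡 k) ∞ G']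
    (h : IsPrincipalBundle m k n G π) (h' : IsPrincipalBundle m k n G' π')
    (hρ : IsLocalDiffeomorph (𝓡 k) (𝓡 k) ∞ ρ) (hu : ContMDiff (𝓡 n) (𝓡 n) ∞ u)
    (hsmul : ∀ (q : Q) (g : G'), u (q <• g) = u q <• ρ g) (hproj : ∀ q, π (u q) = π' q) :
    IsLocalDiffeomorph (𝓡 n) (𝓡 n) ∞ u := by
  intro q
  obtain ⟨A, s, hA, hqA, hsq, hs, hπs⟩ := h'.exists_localSection q
  obtain ⟨B', d', hB', hqB', hB'A, hd', hsd'⟩ := h'.exists_division hA hs hπs hqA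
  obtain ⟨B, d, hB, hqB, hBB', hd, hsd⟩ := h.exists_division hB'
    (s := fun y => u (s y)) (hu.comp_contMDiffOn (hs.mono hB'A))
    (fun y hy => by rw [hproj, hπs y (hB'A hy)]) hqB'
  have hρ1 := hρ 1
  have hsrc : IsOpen hρ1.localInverse.source := hρ1.localInverse_open_source
  have htgt : IsOpen hρ1.localInverse.target := hρ1.localInverse.open_target
  have hdu : ∀ a, π' a ∈ B → d (u a) = ρ (d' a) := fun a ha => by
    have h1 := hsd (u a) (by rwa [hproj])
    rw [hproj] at h1
    refine h.smul_left_cancel (h1.trans ?_)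
    rw [← hsmul, hsd' a (hBB' ha)]
  have hd'q : d' q = 1 := by
    refine h'.smul_left_cancel (p := q) ?_
    conv_lhs => rw [← hsq]
    rw [hsq, ← congrArg (· <• d' q) hsq, hsd' q hqB']
    simp
  refine IsLocalDiffeomorphAt.of_localInverse
    (g := fun p => s (π p) <• hρ1.localInverse (d p))
    (A := π' ⁻¹' B ∩ d' ⁻¹' hρ1.localInverse.target)
    (B := π ⁻¹' B ∩ d ⁻¹' hρ1.localInverse.source) ?_ ?_ ⟨hqB, ?_⟩ ⟨?_, ?_⟩ hu.contMDiffOn ?_ ?_ ?_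
  · exact (hd'.continuousOn.mono (Set.preimage_mono hBB')).isOpen_inter_preimage
      (hB.preimage h'.contMDiff_proj.continuous) htgt
  · exact hd.continuousOn.isOpen_inter_preimage (hB.preimage h.contMDiff_proj.continuous) hsrc
  · rw [Set.mem_preimage, hd'q]
    exact hρ1.localInverse_mem_target
  · rw [Set.mem_preimage, hproj]
    exact hqB
  · rw [Set.mem_preimage, hdu q hqB, hd'q]
    exact hρ1.localInverse_mem_source
  · refine h'.contMDiffOn_smul ?_ ?_
    · exact hs.comp h.contMDiff_proj.contMDiffOn fun p hp => hB'A (hBB' hp.1)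
    · exact hρ1.localInverse_contMDiffOn.comp (hd.mono Set.inter_subset_left) fun p hp => hp.2
  · rintro a ⟨ha, ha'⟩ -
    rw [hdu a ha, hproj, hρ1.localInverse_left_inv ha', hsd' a (hBB' ha)]
  · rintro p ⟨hp, hp'⟩
    rw [hsmul, hρ1.localInverse_right_inv hp', hsd p hp]

theorem surjective_of_equivariant (h : IsPrincipalBundle m k n G π)
    (h' : IsPrincipalBundle m k n G' π') (hρ : Function.Surjective ρ)
    (hsmul : ∀ (q : Q) (g : G'), u (q <• g) = u q <• ρ g) (hproj : ∀ q, π (u q) = π' q) :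
    Function.Surjective u := by
  intro p
  obtain ⟨q, hq⟩ := h'.surjective_proj (π p)
  obtain ⟨g, hg⟩ := h.transitive (u q) p (by rw [hproj, hq])
  obtain ⟨g', rfl⟩ := hρ g
  exact ⟨q <• g', by rw [hsmul, hg]⟩

theorem exists_smul_eq_of_equivariant (h : IsPrincipalBundle m k n G π)
    (h' : IsPrincipalBundle m k n G' π')
    (hsmul : ∀ (q : Q) (g : G'), u (q <• g) = u q <• ρ g) (hproj : ∀ q, π (u q) = π' q)
    {q q' : Q} (hqq' : u q = u q') : ∃ z : G', ρ z = 1 ∧ q <• z = q' := by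
  obtain ⟨z, hz⟩ := h'.transitive q q' (by rw [← hproj, ← hproj, hqq'])
  refine ⟨z, h.free (u q) _ ?_, hz⟩
  rw [← hsmul, hz, hqq']

theorem isCoveringMap_of_equivariant [LieGroup (𝓡 k) ∞ G] [LieGroup (𝓡 k) ∞ G']
    (h : IsPrincipalBundle m k n G π) (h' : IsPrincipalBundle m k n G' π')
    (hρ : IsLocalDiffeomorph (𝓡 k) (𝓡 k) ∞ ρ) (hρs : Function.Surjective ρ)
    (hu : ContMDiff (𝓡 n) (𝓡 n) ∞ u)
    (hsmul : ∀ (q : Q) (g : G'), u (q <• g) = u q <• ρ g) (hproj : ∀ q, π (u q) = π' q) :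
    IsCoveringMap u := by
  have hloc := h.isLocalDiffeomorph_of_equivariant h' hρ hu hsmul hproj
  have hquot : Topology.IsQuotientMap u := hloc.isOpenMap.isQuotientMap hu.continuous
    (h.surjective_of_equivariant h' hρs hsmul hproj)
  suffices hq : IsQuotientCoveringMap u ρ.ker.op from hq.isCoveringMap
  refine { toIsQuotientMap := hquot, continuous_const_smul := ?_, apply_eq_iff_mem_orbit := ?_,
           disjoint := ?_ }
  · rintro ⟨z, -⟩
    exact h'.contMDiff_action.continuous.comp (Continuous.prodMk_left z.unop)
  · intro q q'
    constructor
    · intro hqq'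
      obtain ⟨z, hz, rfl⟩ := h.exists_smul_eq_of_equivariant h' hsmul hproj hqq'.symm
      exact ⟨⟨MulOpposite.op z, hz⟩, rfl⟩
    · rintro ⟨⟨z, hz⟩, rfl⟩
      have := hsmul q' z.unop
      rw [show ρ z.unop = 1 from hz] at this
      exact this.trans (one_smul _ _)
  -- If a and az have fibre coordinates in a set W where ρ is injective, and ρ(z) = 1, then z = 1.
  · intro q
    obtain ⟨e, he, -, -, heq⟩ := h'.locally_trivial (π' q)
    obtain ⟨W, hW, hinj⟩ : ∃ W ∈ 𝓝 (e q).2, Set.InjOn ρ W := by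
      obtain ⟨φ, hφ, hφρ⟩ := hρ.isLocalHomeomorph (e q).2
      exact ⟨φ.source, φ.open_source.mem_nhds hφ, hφρ ▸ φ.injOn⟩
    have hq : q ∈ e.source := e.mem_source.2 he
    refine ⟨e.source ∩ (fun a => (e a).2) ⁻¹' W, Filter.inter_mem (e.open_source.mem_nhds hq)
      ((continuous_snd.continuousAt.comp (e.continuousAt hq)) hW), ?_⟩
    rintro ⟨z, hz⟩ ⟨_, ⟨a, ⟨ha, haW⟩, rfl⟩, -, hzW⟩
    have h1 : (e (a <• z.unop)).2 = (e a).2 * z.unop := heq a ha _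
    have hzW : (e (a <• z.unop)).2 ∈ W := hzW
    rw [h1] at hzW
    have hz : ρ z.unop = 1 := hz
    have := hinj hzW haW (by rw [map_mul, hz, mul_one])
    exact Subtype.ext (MulOpposite.unop_injective (mul_eq_left.1 this))

end IsPrincipalBundle

end EquivariantMap

theorem IsCoveringMap.exists_path_lift {E X : Type*} [TopologicalSpace E] [TopologicalSpace X]
    {p : E → X} (cov : IsCoveringMap p) {x x' : X} (γ : Path x x') {e : E} (he : p e = x) :
    ∃ (e' : E) (Γ : Path e e'), ∀ t, p (Γ t) = γ t := by
  obtain ⟨Γ, hΓ, hΓ0⟩ := cov.exists_path_lifts γ e (by simp [he])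
  exact ⟨Γ 1, ⟨Γ, hΓ0, rfl⟩, fun t => congrFun hΓ t⟩

theorem ChartedSpace.pathConnectedSpace_of_connectedSpace (H : Type*) {X : Type*}
    [TopologicalSpace H] [TopologicalSpace X] [ChartedSpace H X] [LocallyPathConnectedSpace H]
    [ConnectedSpace X] : PathConnectedSpace X :=
  haveI := ChartedSpace.locallyPathConnectedSpace H X
  pathConnectedSpace_iff_connectedSpace.2 inferInstance

theorem FundamentalGroup.ofLoop_map_eq_one {X Y : Type*} [TopologicalSpace X] [TopologicalSpace Y]
    [SimplyConnectedSpace X] (f : C(X, Y)) {x : X} {y : Y} (hx : f x = y) (Γ : Path x x)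
    (γ : Path y y) (hΓ : ∀ t, f (Γ t) = γ t) : ofLoop γ = 1 := by
  have : ofLoop γ = mapOfEq f hx (ofLoop Γ) := by
    rw [mapOfEq_ofLoop]
    congr 1
    ext t
    exact (hΓ t).symm
  rw [this, Subsingleton.elim (ofLoop Γ) 1, map_one]

/-! ### Loops in G and the kernel of ρ. -/

section UniversalCoveringGroup

variable {k : ℕ} {G : Type uG} {G' : Type uH}
  [TopologicalSpace G] [ChartedSpace (EuclideanSpace ℝ (Fin k)) G] [Group G]
  [TopologicalSpace G'] [ChartedSpace (EuclideanSpace ℝ (Fin k)) G'] [Group G'] {ρ : G' →* G}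

theorem IsUniversalCoveringGroup.surjective [ConnectedSpace G]
    (hρ : IsUniversalCoveringGroup k ρ) : Function.Surjective ρ :=
  hρ.isCoveringMap.surjective_of_connected

theorem IsUniversalCoveringGroup.ofLoop_eq_one_iff (hρ : IsUniversalCoveringGroup k ρ)
    (g : Path (1 : G) 1) {z : G'} (g' : Path 1 z) (hg' : ∀ t, ρ (g' t) = g t) :
    FundamentalGroup.ofLoop g = 1 ↔ z = 1 := by
  have := hρ.simplyConnected
  constructor
  · intro hg
    refine (hρ.isCoveringMap.ofLoop_mem_range_mapOfEq_iff (map_one ρ) g g' hg').1 ?_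
    rw [hg]
    exact one_mem _
  · rintro rfl
    exact FundamentalGroup.ofLoop_map_eq_one ⟨ρ, hρ.isCoveringMap.continuous⟩ (map_one ρ) g' g hg'

end UniversalCoveringGroup

/-! ### From spinor structures to complements. -/

namespace SpinorStructure

open FundamentalGroup

variable {m k n : ℕ} {M : Type uM} {P : Type uP} {G : Type uG} {G' : Type uH}
  [TopologicalSpace M] [ChartedSpace (EuclideanSpace ℝ (Fin m)) M]
  [TopologicalSpace P] [ChartedSpace (EuclideanSpace ℝ (Fin n)) P]
  [Group G] [TopologicalSpace G'] [ChartedSpace (EuclideanSpace ℝ (Fin k)) G'] [Group G']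
  [MulAction Gᵐᵒᵖ P] {ρ : G' →* G} {π : P → M}

theorem imageSubgroup_le_of_comp (S T : SpinorStructure m k n ρ π) {p₀ : P} {q₀ : S.Q} {q₁ : T.Q}
    (hq₀ : S.spinorMap q₀ = p₀) (hq₁ : T.spinorMap q₁ = p₀) (a : C(S.Q, T.Q)) (ha : a q₀ = q₁)
    (hTa : ∀ q, T.spinorMap (a q) = S.spinorMap q) :
    S.imageSubgroup q₀ hq₀ ≤ T.imageSubgroup q₁ hq₁ := by
  rintro _ ⟨x, rfl⟩
  obtain ⟨γ, rfl⟩ := ofLoop_surjective x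
  refine ⟨mapOfEq a ha (ofLoop γ), ?_⟩
  rw [mapOfEq_ofLoop, mapOfEq_ofLoop, mapOfEq_ofLoop]
  congr 1
  ext t
  exact hTa _

variable [TopologicalSpace G] [ChartedSpace (EuclideanSpace ℝ (Fin k)) G]

theorem exists_spinorMap_eq [ConnectedSpace G] (S : SpinorStructure m k n ρ π)
    (hρ : IsUniversalCoveringGroup k ρ) (hπ : IsPrincipalBundle m k n G π) (p₀ : P) :
    ∃ q₀, S.spinorMap q₀ = p₀ :=
  hπ.surjective_of_equivariant S.isPrincipalBundle hρ.surjective S.spinorMap_smul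
    S.proj_spinorMap p₀

/-- Two points over p₀ differ by some z in ker ρ, and right translation by z is a deck
transformation of u. No conjugation therefore appears when the base point changes. -/
theorem imageSubgroup_eq (S : SpinorStructure m k n ρ π)
    (hπ : IsPrincipalBundle m k n G π) {p₀ : P} {q₀ q₁ : S.Q}
    (hq₀ : S.spinorMap q₀ = p₀) (hq₁ : S.spinorMap q₁ = p₀) :
    S.imageSubgroup q₀ hq₀ = S.imageSubgroup q₁ hq₁ := by
  have key : ∀ {q₀ q₁ : S.Q} (hq₀ : S.spinorMap q₀ = p₀) (hq₁ : S.spinorMap q₁ = p₀),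
      S.imageSubgroup q₀ hq₀ ≤ S.imageSubgroup q₁ hq₁ := fun {q₀ q₁} hq₀ hq₁ => by
    obtain ⟨z, hz, hzq⟩ := hπ.exists_smul_eq_of_equivariant S.isPrincipalBundle S.spinorMap_smul
      S.proj_spinorMap (hq₀.trans hq₁.symm)
    refine imageSubgroup_le_of_comp S S hq₀ hq₁ ⟨fun q => q <• z,
      S.isPrincipalBundle.contMDiff_action.continuous.comp (Continuous.prodMk_left z)⟩ hzq
      fun q => ?_
    exact (S.spinorMap_smul q z).trans (by rw [hz]; exact one_smul _ _)
  exact le_antisymm (key hq₀ hq₁) (key hq₁ hq₀)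

variable [LieGroup (𝓡 k) ∞ G] [LieGroup (𝓡 k) ∞ G']

theorem isLocalDiffeomorph_spinorMap (S : SpinorStructure m k n ρ π)
    (hρ : IsUniversalCoveringGroup k ρ) (hπ : IsPrincipalBundle m k n G π) :
    IsLocalDiffeomorph (𝓡 n) (𝓡 n) ∞ S.spinorMap :=
  hπ.isLocalDiffeomorph_of_equivariant S.isPrincipalBundle hρ.isLocalDiffeomorph
    S.contMDiff_spinorMap S.spinorMap_smul S.proj_spinorMap

variable [ConnectedSpace G]

theorem isCoveringMap_spinorMap (S : SpinorStructure m k n ρ π)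
    (hρ : IsUniversalCoveringGroup k ρ) (hπ : IsPrincipalBundle m k n G π) :
    IsCoveringMap S.spinorMap :=
  hπ.isCoveringMap_of_equivariant S.isPrincipalBundle hρ.isLocalDiffeomorph hρ.surjective
    S.contMDiff_spinorMap S.spinorMap_smul S.proj_spinorMap

theorem imageSubgroup_inf_range (S : SpinorStructure m k n ρ π)
    (hρ : IsUniversalCoveringGroup k ρ) (hπ : IsPrincipalBundle m k n G π) {p₀ : P} {q₀ : S.Q}
    (hq₀ : S.spinorMap q₀ = p₀) :
    S.imageSubgroup q₀ hq₀ ⊓ (hπ.orbitMapStar p₀).range = ⊥ := by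
  rw [eq_bot_iff]
  rintro _ ⟨hx, y, rfl⟩
  obtain ⟨g, rfl⟩ := ofLoop_surjective y
  obtain ⟨z, g', hg'⟩ := hρ.isCoveringMap.exists_path_lift g (map_one ρ)
  have hx : hπ.orbitMapStar p₀ (ofLoop g) ∈ S.imageSubgroup q₀ hq₀ := hx
  rw [hπ.orbitMapStar_ofLoop] at hx
  have hz := ((S.isCoveringMap_spinorMap hρ hπ).ofLoop_mem_range_mapOfEq_iff hq₀ _
    ((g'.map (S.isPrincipalBundle.orbitMap q₀).continuous).cast (one_smul _ _).symm rfl)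
    (fun t => by
      rw [hπ.smulLoop_apply]
      refine (S.spinorMap_smul q₀ (g' t)).trans ?_
      rw [hg', hq₀]
      rfl)).1 hx
  have hz : z = 1 := S.isPrincipalBundle.free q₀ z hz
  rw [(hρ.ofLoop_eq_one_iff g g' hg').2 hz, map_one]
  exact one_mem _

theorem isComplement_imageSubgroup [ConnectedSpace M] (S : SpinorStructure m k n ρ π)
    (hρ : IsUniversalCoveringGroup k ρ) (hπ : IsPrincipalBundle m k n G π) {p₀ : P}
    (hex : hπ.ExistenceCondition p₀) {q₀ : S.Q} (hq₀ : S.spinorMap q₀ = p₀) :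
    hπ.IsComplement p₀ (S.imageSubgroup q₀ hq₀) := by
  rw [hπ.isComplement_iff hex]
  refine ⟨fun _ _ => Set.mem_univ _, Subgroup.injOn_of_inf_range_eq_bot (hπ.ker_projStar hex)
    (S.imageSubgroup_inf_range hρ hπ hq₀), fun c _ => ?_⟩
  obtain ⟨-, K, hK⟩ := hex
  obtain ⟨x, -, rfl⟩ := hK.bijOn_projStar.surjOn (Set.mem_univ c)
  obtain ⟨γ, rfl⟩ := ofLoop_surjective x
  have cov := S.isCoveringMap_spinorMap hρ hπ
  obtain ⟨q, Γ, hΓ⟩ := cov.exists_path_lift γ hq₀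
  have hq : S.spinorMap q = S.spinorMap q₀ := by
    have := hΓ 1
    rwa [Γ.target, γ.target, ← hq₀] at this
  obtain ⟨z, hz, rfl⟩ := hπ.exists_smul_eq_of_equivariant S.isPrincipalBundle S.spinorMap_smul
    S.proj_spinorMap hq
  have := hρ.simplyConnected
  -- Here qz = q₀, so Γ · g' is a closed lift of γ · ρ(g'), and this loop has the same projection to
  -- M as γ.
  let g' : Path (1 : G') z := PathConnectedSpace.somePath 1 z
  let g : Path (1 : G) 1 := (g'.map hρ.isCoveringMap.continuous).cast (map_one ρ).symm hz.symm
  refine ⟨ofLoop (hπ.smulLoop γ g), ?_, hπ.projStar_smulLoop γ g⟩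
  refine (cov.ofLoop_mem_range_mapOfEq_iff hq₀ _
    (((Γ.prod g').map S.isPrincipalBundle.actionMap.continuous).cast (one_smul _ _).symm rfl)
    (fun t => ?_)).2 rfl
  rw [hπ.smulLoop_apply]
  refine (S.spinorMap_smul (Γ t) (g' t)).trans ?_
  rw [hΓ]
  rfl

theorem equivalent_of_imageSubgroup_eq [ConnectedSpace M] {S T : SpinorStructure m k n ρ π}
    (hρ : IsUniversalCoveringGroup k ρ) (hπ : IsPrincipalBundle m k n G π) {p₀ : P} {q₀ : S.Q}
    {q₁ : T.Q} (hq₀ : S.spinorMap q₀ = p₀) (hq₁ : T.spinorMap q₁ = p₀)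
    (hST : S.imageSubgroup q₀ hq₀ ≤ T.imageSubgroup q₁ hq₁) : S.Equivalent T := by
  have := hρ.simplyConnected
  have := S.isPrincipalBundle.connectedSpace
  have : LocallyPathConnectedSpace S.Q :=
    ChartedSpace.locallyPathConnectedSpace (EuclideanSpace ℝ (Fin n)) S.Q
  have : PathConnectedSpace S.Q :=
    ChartedSpace.pathConnectedSpace_of_connectedSpace (EuclideanSpace ℝ (Fin n))
  subst hq₀
  have cov := T.isCoveringMap_spinorMap hρ hπ
  obtain ⟨a, ⟨ha₀, ha⟩, -⟩ := cov.existsUnique_continuousMap_lifts_of_range_le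
    (f := ⟨S.spinorMap, S.contMDiff_spinorMap.continuous⟩) (a₀ := q₀) (e₀ := q₁) hq₁ (by
      rintro _ ⟨x, rfl⟩
      obtain ⟨γ, rfl⟩ := ofLoop_surjective x
      refine hST ⟨ofLoop γ, ?_⟩
      rw [mapOfEq_ofLoop]
      rfl)
  have hTa : ∀ q, T.spinorMap (a q) = S.spinorMap q := fun q => congrFun ha q
  refine ⟨a, ?_, fun q g => ?_, fun q => ?_, hTa⟩
  · exact (T.isLocalDiffeomorph_spinorMap hρ hπ).contMDiff_of_comp a.continuous
      (S.contMDiff_spinorMap.congr hTa)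
  · have hcont : Continuous fun x : S.Q × G' => a (x.1 <• x.2) :=
      a.continuous.comp S.isPrincipalBundle.contMDiff_action.continuous
    have hcont' : Continuous fun x : S.Q × G' => a x.1 <• x.2 :=
      T.isPrincipalBundle.contMDiff_action.continuous.comp
        ((a.continuous.comp continuous_fst).prodMk continuous_snd)
    -- Equivariance is uniqueness of lifts over the connected space Q × G̃: both maps lift the same
    -- map to P and agree at (q₀, 1).
    have := cov.eq_of_comp_eq hcont hcont' (by
      ext x
      simp only [Function.comp_apply]
      rw [hTa, S.spinorMap_smul, T.spinorMap_smul, hTa]) (q₀, 1) (by simp)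
    exact congrFun this (q, g)
  · rw [← T.proj_spinorMap, hTa, S.proj_spinorMap]

/-- The morphism gives one inclusion. Equality follows because π_* is bijective on both subgroups,
so the morphism need not be inverted; symmetry of equivalence is later deduced from this. -/
theorem Equivalent.imageSubgroup_eq [ConnectedSpace M] {S T : SpinorStructure m k n ρ π}
    (hST : S.Equivalent T)
    (hρ : IsUniversalCoveringGroup k ρ) (hπ : IsPrincipalBundle m k n G π) {p₀ : P}
    (hex : hπ.ExistenceCondition p₀) {q₀ : S.Q} {q₁ : T.Q}
    (hq₀ : S.spinorMap q₀ = p₀) (hq₁ : T.spinorMap q₁ = p₀) :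
    S.imageSubgroup q₀ hq₀ = T.imageSubgroup q₁ hq₁ := by
  obtain ⟨a, ha, -, -, hTa⟩ := hST
  have hq : T.spinorMap (a q₀) = p₀ := (hTa q₀).trans hq₀
  rw [T.imageSubgroup_eq hπ hq₁ hq]
  have hle := imageSubgroup_le_of_comp S T hq₀ hq ⟨a, ha.continuous⟩ rfl hTa
  refine le_antisymm hle fun x hx => ?_
  have hS := (S.isComplement_imageSubgroup hρ hπ hex hq₀).bijOn_projStar
  have hT := (T.isComplement_imageSubgroup hρ hπ hex hq).bijOn_projStar
  obtain ⟨y, hy, hyx⟩ := hS.surjOn (Set.mem_univ (hπ.projStar p₀ x))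
  rwa [← hT.injOn (hle hy) hx hyx]

end SpinorStructure

/-! ### The covering space belonging to a subgroup of π₁. -/

section CoveringOfSubgroup

open scoped Topology

variable {X : Type*} [TopologicalSpace X]

namespace Path.Homotopic.Quotient

variable {a b c d : X}

theorem symm_trans_rev (p : Path.Homotopic.Quotient a b) (q : Path.Homotopic.Quotient b c) :
    (p.trans q).symm = q.symm.trans p.symm := by
  obtain ⟨p, rfl⟩ := mk_surjective p
  obtain ⟨q, rfl⟩ := mk_surjective q
  rw [← mk_trans, ← mk_symm, Path.trans_symm, mk_trans, mk_symm, mk_symm]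

theorem symm_trans_trans (q : Path.Homotopic.Quotient c b)
    (r : Path.Homotopic.Quotient b d) : q.symm.trans (q.trans r) = r := by
  rw [← trans_assoc, symm_trans, refl_trans]

theorem trans_trans_symm_self (p : Path.Homotopic.Quotient a b)
    (q : Path.Homotopic.Quotient b c) : (p.trans q).trans q.symm = p := by
  rw [trans_assoc, trans_symm, trans_refl]

theorem trans_trans_trans_symm (p : Path.Homotopic.Quotient a b) (q : Path.Homotopic.Quotient d b)
    (r : Path.Homotopic.Quotient b c) :
    (p.trans r).trans (q.trans r).symm = p.trans q.symm := by
  rw [symm_trans_rev, ← trans_assoc, trans_trans_symm_self]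

end Path.Homotopic.Quotient

theorem IsOpen.eventually_exists_path [LocallyPathConnectedSpace X] {U : Set X} (hU : IsOpen U)
    {x : X} (hx : x ∈ U) : ∀ᶠ y in 𝓝 x, ∃ σ : Path x y, ∀ t, σ t ∈ U := by
  filter_upwards [pathComponentIn_mem_nhds (hU.mem_nhds hx)] with y hy
  obtain ⟨σ, hσ⟩ := (hy : JoinedIn U x y)
  exact ⟨σ, hσ⟩

open Path.Homotopic.Quotient in
theorem exists_pathFrame [PathConnectedSpace X] (x₀ : X) {U : Set X} [SimplyConnectedSpace U] :
    ∃ h : ∀ x, Path.Homotopic.Quotient x₀ x, ∀ (x y : X) (σ : Path x y), (∀ t, σ t ∈ U) →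
      h y = (h x).trans (mk σ) := by
  classical
  obtain ⟨i⟩ : Nonempty U := inferInstance
  let w : Path.Homotopic.Quotient x₀ i.1 := mk (PathConnectedSpace.somePath x₀ i.1)
  -- Run to a fixed point of U and then inside U; simple connectedness removes the dependence on the
  -- path chosen there. The value outside U is arbitrary.
  let h : ∀ x, Path.Homotopic.Quotient x₀ x := fun x =>
    if hx : x ∈ U then
      w.trans (mk ((PathConnectedSpace.somePath i ⟨x, hx⟩).map continuous_subtype_val))
    else mk (PathConnectedSpace.somePath x₀ x)
  have hh : ∀ (x : U) (τ : Path i x), h x = w.trans (mk (τ.map continuous_subtype_val)) := by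
    intro x τ
    simp only [h, dif_pos x.2]
    congr 1
    exact eq.2 ((SimplyConnectedSpace.paths_homotopic _ τ).map ⟨_, continuous_subtype_val⟩)
  refine ⟨h, fun x y σ hσ => ?_⟩
  have hx : x ∈ U := by simpa using hσ 0
  have hy : y ∈ U := by simpa using hσ 1
  let τ : Path i ⟨x, hx⟩ := PathConnectedSpace.somePath _ _
  let σ' : Path (⟨x, hx⟩ : U) ⟨y, hy⟩ :=
    ⟨⟨fun t => ⟨σ t, hσ t⟩, by fun_prop⟩, Subtype.ext σ.source, Subtype.ext σ.target⟩
  have hσ' : σ'.map continuous_subtype_val = σ := rfl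
  rw [hh ⟨x, hx⟩ τ, hh ⟨y, hy⟩ (τ.trans σ'), Path.map_trans, mk_trans, trans_assoc, hσ']

/-- Open sets `U i ∋ i` together with classes of paths `h i x` from `x₀` to `x`, such that for fixed
`i` the classes differ by paths inside `U i`. -/
structure PathFrame (x₀ : X) where
  /-- The open sets of the cover. -/
  U : X → Set X
  isOpen_U : ∀ i, IsOpen (U i)
  mem_U : ∀ i, i ∈ U i
  /-- The frames. -/
  h : ∀ _ x : X, Path.Homotopic.Quotient x₀ x
  h_path : ∀ (i x y : X) (σ : Path x y), (∀ t, σ t ∈ U i) →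
    h i y = (h i x).trans (Path.Homotopic.Quotient.mk σ)

theorem PathFrame.exists_of_simplyConnected [PathConnectedSpace X] (x₀ : X)
    (hX : ∀ x : X, ∃ U : Set X, IsOpen U ∧ x ∈ U ∧ SimplyConnectedSpace U) :
    Nonempty (PathFrame x₀) := by
  choose U hU hxU hsc using hX
  choose h hh using fun i => exists_pathFrame x₀ (U := U i)
  exact ⟨⟨U, hU, hxU, h, hh⟩⟩

/-- The cosets of a subgroup of the fundamental group, with the discrete topology. -/
def CosetFiber {x₀ : X} (K : Subgroup (FundamentalGroup X x₀)) := FundamentalGroup X x₀ ⧸ K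

namespace CosetFiber

variable {x₀ : X} (K : Subgroup (FundamentalGroup X x₀))

instance : TopologicalSpace (CosetFiber K) := ⊥

instance : DiscreteTopology (CosetFiber K) := ⟨rfl⟩

noncomputable instance : MulAction (FundamentalGroup X x₀) (CosetFiber K) :=
  inferInstanceAs (MulAction (FundamentalGroup X x₀) (FundamentalGroup X x₀ ⧸ K))

/-- The coset of a class of loops. -/
noncomputable def mk (w : Path.Homotopic.Quotient x₀ x₀) : CosetFiber K :=
  QuotientGroup.mk (s := K) (w : FundamentalGroup X x₀)

variable {K}

theorem mk_surjective (v : CosetFiber K) : ∃ w, mk K w = v := QuotientGroup.mk_surjective v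

theorem mk_eq_mk_iff (v w : Path.Homotopic.Quotient x₀ x₀) :
    mk K v = mk K w ↔ FundamentalGroup.fromPath (w.trans v.symm) ∈ K :=
  QuotientGroup.eq (s := K)

end CosetFiber

namespace PathFrame

open Path.Homotopic.Quotient

variable {x₀ : X} (F : PathFrame x₀) (K : Subgroup (FundamentalGroup X x₀))

/-- The transition elements of a path frame. -/
noncomputable def transition (i j x : X) : FundamentalGroup X x₀ := (F.h i x).trans (F.h j x).symm

/-- Both frames are extended by the same path, which cancels. Transition elements are thus locally
constant, which makes the coordinate changes continuous. -/
theorem transition_eq_of_path {i j x y : X} (σ : Path x y) (hi : ∀ t, σ t ∈ F.U i)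
    (hj : ∀ t, σ t ∈ F.U j) : F.transition i j y = F.transition i j x := by
  rw [transition, F.h_path i x y σ hi, F.h_path j x y σ hj, trans_trans_trans_symm]
  rfl

/-- The bundle core of the covering space which belongs to the subgroup `K`. -/
noncomputable def core [LocallyPathConnectedSpace X] : FiberBundleCore X X (CosetFiber K) where
  baseSet := F.U
  isOpen_baseSet := F.isOpen_U
  indexAt := id
  mem_baseSet_at := F.mem_U
  coordChange i j x v := F.transition i j x • v
  coordChange_self i x _ v := by
    have : F.transition i i x = 1 := trans_symm _
    rw [this, one_smul]
  continuousOn_coordChange i j := by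
    rintro ⟨x, v⟩ ⟨hx, -⟩
    have hev : ∀ᶠ y in 𝓝 x, F.transition i j y = F.transition i j x := by
      filter_upwards [((F.isOpen_U i).inter (F.isOpen_U j)).eventually_exists_path hx] with y hy
      obtain ⟨σ, hσ⟩ := hy
      exact F.transition_eq_of_path σ (fun t => (hσ t).1) fun t => (hσ t).2
    have hcont : ContinuousAt (fun p : X × CosetFiber K => F.transition i j x • p.2) (x, v) :=
      (continuous_of_discreteTopology.comp continuous_snd).continuousAt
    refine (hcont.congr ?_).continuousWithinAt
    filter_upwards [continuous_fst.continuousAt.eventually hev] with p hp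
    rw [hp]
  coordChange_comp i j l x _ v := by
    rw [← mul_smul]
    congr 1
    change ((F.h i x).trans (F.h j x).symm).trans ((F.h j x).trans (F.h l x).symm) = _
    rw [trans_assoc, symm_trans_trans]
    rfl

variable [LocallyPathConnectedSpace X]

/-- The point over `x` given by a class of paths from `x₀` to `x`. -/
noncomputable def pt (x : X) (w : Path.Homotopic.Quotient x₀ x) : (F.core K).TotalSpace :=
  ⟨x, CosetFiber.mk K (w.trans (F.h x x).symm)⟩

theorem pt_surjective (e : (F.core K).TotalSpace) : ∃ x w, F.pt K x w = e := by
  obtain ⟨x, v⟩ := e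
  obtain ⟨w, rfl⟩ := CosetFiber.mk_surjective v
  refine ⟨x, w.trans (F.h x x), ?_⟩
  rw [pt, trans_trans_symm_self]

theorem pt_eq_pt_refl_iff {w : Path.Homotopic.Quotient x₀ x₀} :
    F.pt K x₀ w = F.pt K x₀ (.refl x₀) ↔ FundamentalGroup.fromPath w ∈ K := by
  have h1 : F.pt K x₀ w = F.pt K x₀ (.refl x₀) ↔ CosetFiber.mk K (w.trans (F.h x₀ x₀).symm) =
      CosetFiber.mk K ((Path.Homotopic.Quotient.refl x₀).trans (F.h x₀ x₀).symm) :=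
    ⟨fun h => eq_of_heq (Bundle.TotalSpace.mk.inj h).2, fun h => by rw [pt, pt, h]⟩
  rw [h1, eq_comm, CosetFiber.mk_eq_mk_iff, trans_trans_trans_symm]
  have h2 : (Path.Homotopic.Quotient.refl x₀).symm = .refl x₀ := by
    rw [← mk_refl, ← mk_symm, Path.refl_symm]
  rw [h2, trans_refl]

theorem isCoveringMap_core : IsCoveringMap (F.core K).proj :=
  FiberBundle.isCoveringMap (F := CosetFiber K) (E := (F.core K).Fiber)

/-- Near a the class w and the frame at f a are extended by the same path σ, so in that
trivialisation the fibre coordinate is constant. -/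
theorem continuousAt_pt {A : Type*} [TopologicalSpace A] {f : A → X} {a : A}
    (w : ∀ a, Path.Homotopic.Quotient x₀ (f a)) (hf : ContinuousAt f a)
    (hw : ∀ᶠ b in 𝓝 a, ∃ σ : Path (f a) (f b), (∀ t, σ t ∈ F.U (f a)) ∧
      w b = (w a).trans (.mk σ)) : ContinuousAt (fun b => F.pt K (f b) (w b)) a := by
  rw [FiberBundle.continuousAt_totalSpace]
  refine ⟨hf, ?_⟩
  refine (continuousAt_const (y := CosetFiber.mk K ((w a).trans (F.h (f a) (f a)).symm))).congr ?_
  filter_upwards [hw] with b hb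
  obtain ⟨σ, hσ, hwb⟩ := hb
  change _ = F.transition (f b) (f a) (f b) • CosetFiber.mk K ((w b).trans (F.h (f b) (f b)).symm)
  change _ = CosetFiber.mk K (((w b).trans (F.h (f b) (f b)).symm).trans
    ((F.h (f b) (f b)).trans (F.h (f a) (f b)).symm))
  rw [trans_assoc, symm_trans_trans, hwb, F.h_path (f a) (f a) (f b) σ hσ, trans_trans_trans_symm]

end PathFrame

instance : SimplyConnectedSpace unitInterval :=
  haveI : ContractibleSpace unitInterval :=
    (convex_Icc (0 : ℝ) 1).contractibleSpace ⟨0, by simp⟩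
  inferInstance

instance : LocallyPathConnectedSpace unitInterval :=
  (convex_Icc (0 : ℝ) 1).locallyPathConnectedSpace

namespace Path

/-- The class of the initial piece of a path. -/
noncomputable def initialPiece {x y : X} (γ : Path x y) (t : unitInterval) :
    Path.Homotopic.Quotient x (γ t) :=
  .mk (((PathConnectedSpace.somePath 0 t).map γ.continuous).cast γ.source.symm rfl)

theorem initialPiece_eq {x y : X} (γ : Path x y) {t : unitInterval} (s : Path 0 t) :
    γ.initialPiece t = .mk ((s.map γ.continuous).cast γ.source.symm rfl) :=
  Path.Homotopic.Quotient.eq.2 <| Path.Homotopic.pathCast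
    ((SimplyConnectedSpace.paths_homotopic _ s).map γ.toContinuousMap) _ _

theorem initialPiece_trans {x y : X} (γ : Path x y) {t t' : unitInterval} (s : Path t t') :
    γ.initialPiece t' = (γ.initialPiece t).trans (.mk (s.map γ.continuous)) := by
  rw [γ.initialPiece_eq ((PathConnectedSpace.somePath 0 t).trans s), initialPiece,
    ← Path.Homotopic.Quotient.mk_trans, Path.map_trans]
  rfl

end Path

namespace PathFrame

variable {x₀ : X} (F : PathFrame x₀) (K : Subgroup (FundamentalGroup X x₀))
  [LocallyPathConnectedSpace X]

open Path.Homotopic.Quotient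

theorem pt_eq_of_cast {x y : X} (w : Path.Homotopic.Quotient x₀ x) (h : y = x) :
    F.pt K y (w.cast rfl h) = F.pt K x w := by
  subst h
  simp

/-- The lift at time t is w followed by γ restricted to [0, t]. For nearby times these classes
differ by a piece of γ inside one set of the cover, so `continuousAt_pt` applies. -/
theorem exists_lift {x y : X} (γ : Path x y) (w : Path.Homotopic.Quotient x₀ x) :
    ∃ Γ : Path (F.pt K x w) (F.pt K y (w.trans (.mk γ))), ∀ t, (Γ t).proj = γ t := by
  have hcont : Continuous fun t => F.pt K (γ t) (w.trans (γ.initialPiece t)) := by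
    rw [continuous_iff_continuousAt]
    intro t
    refine F.continuousAt_pt K _ γ.continuous.continuousAt ?_
    filter_upwards [((F.isOpen_U (γ t)).preimage γ.continuous).eventually_exists_path
      (F.mem_U (γ t))] with t' ht'
    obtain ⟨s, hs⟩ := ht'
    refine ⟨s.map γ.continuous, hs, ?_⟩
    rw [γ.initialPiece_trans s, trans_assoc]
  refine ⟨⟨⟨_, hcont⟩, ?_, ?_⟩, fun t => rfl⟩
  · change F.pt K (γ 0) (w.trans (γ.initialPiece 0)) = _
    rw [← F.pt_eq_of_cast K w γ.source, γ.initialPiece_eq (Path.refl 0)]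
    have key : ∀ z (hz : z = x) (σ : Path x z), (∀ t, σ t = x) →
        w.trans (.mk σ) = w.cast rfl hz := by
      rintro z rfl σ hσ
      rw [show σ = Path.refl z from Path.ext (funext hσ), mk_refl, trans_refl, cast_rfl_rfl]
    exact congrArg _ (key _ γ.source _ fun _ => γ.source)
  · change F.pt K (γ 1) (w.trans (γ.initialPiece 1)) = _
    rw [← F.pt_eq_of_cast K _ γ.target, γ.initialPiece_eq (t := 1) ⟨.id _, rfl, rfl⟩]
    congr 1
    obtain ⟨w, rfl⟩ := mk_surjective w
    rfl

/-- The lift of γ from the base point ends at the point named by γ itself, which is the base point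
exactly when γ lies in K. -/
theorem range_mapOfEq_eq (h : (F.core K).proj (F.pt K x₀ (.refl x₀)) = x₀) :
    (FundamentalGroup.mapOfEq (x := F.pt K x₀ (.refl x₀))
      ⟨(F.core K).proj, (F.isCoveringMap_core K).continuous⟩ h).range =
      K := by
  ext a
  obtain ⟨γ, rfl⟩ := FundamentalGroup.ofLoop_surjective a
  obtain ⟨Γ, hΓ⟩ := F.exists_lift K γ (.refl x₀)
  rw [(F.isCoveringMap_core K).ofLoop_mem_range_mapOfEq_iff h γ Γ hΓ, F.pt_eq_pt_refl_iff K,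
    Path.Homotopic.Quotient.refl_trans]
  rfl

theorem pathConnectedSpace_core : PathConnectedSpace (F.core K).TotalSpace := by
  refine pathConnectedSpace_iff_univ.2 ⟨F.pt K x₀ (.refl x₀), Set.mem_univ _, fun {e} _ => ?_⟩
  obtain ⟨x, w, rfl⟩ := F.pt_surjective K e
  obtain ⟨γ, rfl⟩ := Path.Homotopic.Quotient.mk_surjective w
  obtain ⟨Γ, -⟩ := F.exists_lift K γ (.refl x₀)
  rw [Path.Homotopic.Quotient.refl_trans] at Γ
  exact joinedIn_univ.2 ⟨Γ⟩

end PathFrame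

/-- The covering space which belongs to a subgroup of the fundamental group. -/
theorem exists_isCoveringMap_range_eq {X : Type uP} [TopologicalSpace X] [PathConnectedSpace X]
    [LocallyPathConnectedSpace X]
    (hX : ∀ x : X, ∃ U : Set X, IsOpen U ∧ x ∈ U ∧ SimplyConnectedSpace U) {x₀ : X}
    (K : Subgroup (FundamentalGroup X x₀)) :
    ∃ (E : Type uP) (_ : TopologicalSpace E) (p : E → X) (cov : IsCoveringMap p) (e₀ : E)
      (he₀ : p e₀ = x₀), PathConnectedSpace E ∧
        (FundamentalGroup.mapOfEq ⟨p, cov.continuous⟩ he₀).range = K := by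
  obtain ⟨F⟩ := PathFrame.exists_of_simplyConnected x₀ hX
  exact ⟨(F.core K).TotalSpace, inferInstance, (F.core K).proj, F.isCoveringMap_core K,
    F.pt K x₀ (.refl x₀), rfl, F.pathConnectedSpace_core K, F.range_mapOfEq_eq K _⟩

theorem ChartedSpace.exists_simplyConnected_nhds {n : ℕ} {X : Type*} [TopologicalSpace X]
    [ChartedSpace (EuclideanSpace ℝ (Fin n)) X] (x : X) :
    ∃ U : Set X, IsOpen U ∧ x ∈ U ∧ SimplyConnectedSpace U := by
  let e := chartAt (EuclideanSpace ℝ (Fin n)) x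
  obtain ⟨r, hr, hball⟩ := Metric.isOpen_iff.1 e.open_target (e x) (mem_chart_target _ x)
  have hc : ContractibleSpace (Metric.ball (e x) r) :=
    (convex_ball (e x) r).contractibleSpace ⟨e x, Metric.mem_ball_self hr⟩
  have himage : e.symm '' Metric.ball (e x) r = e.source ∩ e ⁻¹' Metric.ball (e x) r := by
    rw [e.symm_image_eq_source_inter_preimage hball]
  refine ⟨e.symm '' Metric.ball (e x) r, ?_, ?_, ?_⟩
  · rw [himage]
    exact e.isOpen_inter_preimage Metric.isOpen_ball
  · rw [himage]
    exact ⟨mem_chart_source _ x, Metric.mem_ball_self hr⟩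
  · exact (e.symm.homeomorphOfImageSubsetSource hball rfl).symm.toHomotopyEquiv.simplyConnectedSpace

end CoveringOfSubgroup

/-! ### Smooth structure pulled back along a local homeomorphism. -/

section PullbackManifold

variable {H : Type*} [TopologicalSpace H] {X E : Type*} [TopologicalSpace X] [TopologicalSpace E]
  [ChartedSpace H X]

/-- The charted space structure pulled back along a local homeomorphism. -/
@[reducible]
noncomputable def IsLocalHomeomorph.pullbackChartedSpace {p : E → X} (hp : IsLocalHomeomorph p) :
    ChartedSpace H E where
  atlas := {c | ∃ (φ : OpenPartialHomeomorph E X) (x : X), p = φ ∧ c = φ.trans (chartAt H x)}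
  chartAt e := (hp e).choose.trans (chartAt H (p e))
  mem_chart_source e := by
    have h := (hp e).choose_spec
    have hmem : (hp e).choose e ∈ (chartAt H (p e)).source := by
      have : p e = (hp e).choose e := congrFun h.2 e
      rw [← this]
      exact mem_chart_source H (p e)
    exact ⟨h.1, hmem⟩
  chart_mem_atlas e := ⟨(hp e).choose, p e, (hp e).choose_spec.2, rfl⟩

variable {𝕜 : Type*} [NontriviallyNormedField 𝕜] {V : Type*} [NormedAddCommGroup V]
  [NormedSpace 𝕜 V] {I : ModelWithCorners 𝕜 V H} {r : WithTop ℕ∞} [IsManifold I r X]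

theorem IsLocalHomeomorph.isManifold_pullback {p : E → X} (hp : IsLocalHomeomorph p) :
    letI : ChartedSpace H E := hp.pullbackChartedSpace
    IsManifold I r E := by
  let : ChartedSpace H E := hp.pullbackChartedSpace
  refine isManifold_of_contDiffOn I r E ?_
  rintro _ _ ⟨φ, x, hφ, rfl⟩ ⟨φ', x', hφ', rfl⟩
  have hcompat : ContDiffOn 𝕜 r
      (I ∘ ((chartAt H x).symm.trans (chartAt H x')) ∘ I.symm)
      (I.symm ⁻¹' ((chartAt H x).symm.trans (chartAt H x')).source ∩ Set.range I) :=
    (mem_groupoid_of_pregroupoid.1 ((contDiffGroupoid r I).compatible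
      (chart_mem_atlas H x) (chart_mem_atlas H x'))).1
  -- Both φ and φ' are restrictions of p, so they cancel and the transition map is one of X.
  have hφφ' : ∀ z ∈ (chartAt H x).target, (chartAt H x).symm z ∈ φ.target →
      φ' (φ.symm ((chartAt H x).symm z)) = (chartAt H x).symm z := fun z _ hz => by
    rw [← hφ', hφ, φ.right_inv hz]
  have hsrc : ∀ z ∈ ((φ.trans (chartAt H x)).symm.trans (φ'.trans (chartAt H x'))).source,
      z ∈ (chartAt H x).target ∧ (chartAt H x).symm z ∈ φ.target ∧
        φ' (φ.symm ((chartAt H x).symm z)) ∈ (chartAt H x').source := by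
    intro z hz
    simp only [OpenPartialHomeomorph.trans_source, OpenPartialHomeomorph.symm_source,
      Set.mem_inter_iff, Set.mem_preimage,
      OpenPartialHomeomorph.trans_symm_eq_symm_trans_symm,
      OpenPartialHomeomorph.coe_trans, Function.comp_apply] at hz
    exact ⟨hz.1.1, hz.1.2, hz.2.2⟩
  refine (hcompat.mono ?_).congr ?_
  · rintro y ⟨hy, hyI⟩
    obtain ⟨h1, h2, h3⟩ := hsrc _ hy
    rw [hφφ' _ h1 h2] at h3
    exact ⟨⟨h1, h3⟩, hyI⟩
  · rintro y ⟨hy, hyI⟩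
    obtain ⟨h1, h2, -⟩ := hsrc _ hy
    change I (chartAt H x' (φ' (φ.symm ((chartAt H x).symm (I.symm y))))) = _
    rw [hφφ' _ h1 h2]
    rfl

theorem IsLocalHomeomorph.isLocalDiffeomorph_pullback {p : E → X} (hp : IsLocalHomeomorph p) :
    letI : ChartedSpace H E := hp.pullbackChartedSpace
    IsLocalDiffeomorph I I r p := by
  let : ChartedSpace H E := hp.pullbackChartedSpace
  have : IsManifold I r E := hp.isManifold_pullback
  intro e
  obtain ⟨φ, hφ, hpφ, hchart⟩ : ∃ φ : OpenPartialHomeomorph E X, e ∈ φ.source ∧ p = φ ∧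
      chartAt H e = φ.trans (chartAt H (p e)) :=
    ⟨(hp e).choose, (hp e).choose_spec.1, (hp e).choose_spec.2, rfl⟩
  set c := chartAt H (p e) with hc
  have hE : ContMDiffOn I I r (φ.trans c) (φ.trans c).source := hchart ▸ contMDiffOn_chart
  have hE' : ContMDiffOn I I r (φ.trans c).symm (φ.trans c).target :=
    hchart ▸ contMDiffOn_chart_symm
  have hX : ContMDiffOn I I r c c.source := contMDiffOn_chart
  have hX' : ContMDiffOn I I r c.symm c.target := contMDiffOn_chart_symm
  have hpc : ∀ a ∈ (φ.trans c).source, p a ∈ c.source := fun a ha => by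
    rw [hpφ]
    exact ha.2
  have hcp : ∀ a, (φ.trans c) a = c (p a) := fun a => by rw [hpφ]; rfl
  refine IsLocalDiffeomorphAt.of_localInverse (A := (φ.trans c).source)
    (B := c.source ∩ c ⁻¹' (φ.trans c).target) (g := (φ.trans c).symm ∘ c)
    (φ.trans c).open_source (c.isOpen_inter_preimage (φ.trans c).open_target)
    ?_ ?_ ?_ ?_ ?_ ?_
  · exact hchart ▸ mem_chart_source H e
  · refine ⟨mem_chart_source H (p e), ?_⟩
    rw [Set.mem_preimage, ← hcp]
    exact (φ.trans c).map_source (hchart ▸ mem_chart_source H e)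
  · refine (hX'.comp hE fun a ha => ?_).congr fun a ha => ?_
    · rw [Set.mem_preimage, hcp]
      exact c.map_source (hpc a ha)
    · rw [Function.comp_apply, hcp, c.left_inv (hpc a ha)]
  · exact hE'.comp (hX.mono Set.inter_subset_left) fun b hb => hb.2
  · rintro a ha -
    rw [Function.comp_apply, ← hcp, (φ.trans c).left_inv ha]
  · rintro b ⟨hb, hb'⟩
    have h2 : c.symm (c b) ∈ φ.target := hb'.2
    change p (φ.symm (c.symm (c b))) = b
    rw [hpφ, φ.right_inv h2, c.left_inv hb]

end PullbackManifold

theorem IsCoveringMap.t2Space {E X : Type*} [TopologicalSpace E] [TopologicalSpace X] [T2Space X]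
    {p : E → X} (cov : IsCoveringMap p) : T2Space E := by
  refine ⟨fun a b hab => ?_⟩
  by_cases h : p a = p b
  · exact cov.isSeparatedMap a b h hab
  · obtain ⟨U, V, hU, hV, ha, hb, hUV⟩ := t2_separation h
    exact ⟨p ⁻¹' U, p ⁻¹' V, hU.preimage cov.continuous, hV.preimage cov.continuous, ha, hb,
      hUV.preimage p⟩

theorem IsLocalHomeomorph.eventuallyEq_of_comp_eventuallyEq {E X A : Type*} [TopologicalSpace E]
    [TopologicalSpace X] [TopologicalSpace A] {p : E → X} (hp : IsLocalHomeomorph p) {f g : A → E}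
    {a : A} (hf : ContinuousAt f a) (hg : ContinuousAt g a) (hfg : f a = g a)
    (h : ∀ᶠ b in nhds a, p (f b) = p (g b)) : f =ᶠ[nhds a] g := by
  obtain ⟨φ, hφ, hpφ⟩ := hp (f a)
  filter_upwards [hf.eventually (φ.open_source.mem_nhds hφ),
    hg.eventually (φ.open_source.mem_nhds (hfg ▸ hφ)), h] with b hb hb' hbb'
  rw [hpφ] at hbb'
  exact φ.injOn hb hb' hbb'

/-! ### Lifting the group action to the covering. -/

section CoveringBundle

open FundamentalGroup

variable {m k n : ℕ} {M : Type uM} {P : Type uP} {E : Type*} {G : Type uG} {G' : Type uH}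
  [TopologicalSpace M] [ChartedSpace (EuclideanSpace ℝ (Fin m)) M]
  [TopologicalSpace P] [ChartedSpace (EuclideanSpace ℝ (Fin n)) P]
  [TopologicalSpace G] [ChartedSpace (EuclideanSpace ℝ (Fin k)) G] [Group G]
  [TopologicalSpace G'] [ChartedSpace (EuclideanSpace ℝ (Fin k)) G'] [Group G']
  [MulAction Gᵐᵒᵖ P] {ρ : G' →* G} {π : P → M}

namespace IsPrincipalBundle

/-- Countably many trivialisations cover the total space. Applied to the lifted bundle, this gives
second countability of the covering space without counting π₁(P). -/
theorem secondCountableTopology [SecondCountableTopology M] [SecondCountableTopology G]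
    (h : IsPrincipalBundle m k n G π) : SecondCountableTopology P := by
  choose e he _ using h.locally_trivial
  obtain ⟨s, hs, hcover⟩ := TopologicalSpace.countable_cover_nhds
    fun x => (e x).open_baseSet.mem_nhds (he x)
  have := hs.to_subtype
  have : ∀ x : s, SecondCountableTopology (e x).source := fun x =>
    (e x).toOpenPartialHomeomorph.secondCountableTopology_source
  refine TopologicalSpace.secondCountableTopology_of_countable_cover
    (U := fun x : s => (e x).source) (fun x => (e x).open_source) ?_
  refine Set.eq_univ_of_forall fun p => ?_
  obtain ⟨x, hx, hpx⟩ := Set.mem_iUnion₂.1 (hcover ▸ Set.mem_univ (π p))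
  exact Set.mem_iUnion.2 ⟨⟨x, hx⟩, (e x).mem_source.2 hpx⟩

variable [TopologicalSpace E] {p : E → P}

/-- The action of the structure group lifts to an action of its universal covering group. -/
theorem exists_mulAction_lift [PathConnectedSpace E] [LocallyPathConnectedSpace E]
    [ContinuousMul G']
    (h : IsPrincipalBundle m k n G π) (hρ : IsUniversalCoveringGroup k ρ) (cov : IsCoveringMap p) :
    ∃ _ : MulAction G'ᵐᵒᵖ E, Continuous (fun x : E × G' => x.1 <• x.2) ∧
      ∀ (e : E) (g : G'), p (e <• g) = p e <• ρ g := by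
  have := hρ.simplyConnected
  have : LocallyPathConnectedSpace G' :=
    ChartedSpace.locallyPathConnectedSpace (EuclideanSpace ℝ (Fin k)) G'
  obtain ⟨e₀⟩ : Nonempty E := inferInstance
  let f : C(E × G', P) := ⟨fun x => p x.1 <• ρ x.2, h.contMDiff_action.continuous.comp
    ((cov.continuous.comp continuous_fst).prodMk (hρ.isCoveringMap.continuous.comp continuous_snd))⟩
  have hf : ∀ e, f (e, 1) = p e := fun e => by
    change p e <• ρ 1 = p e
    simp
  obtain ⟨μ, ⟨hμ₀, hμ⟩, -⟩ := cov.existsUnique_continuousMap_lifts_of_range_le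
    (f := f) (a₀ := (e₀, 1)) (e₀ := e₀) (hf e₀).symm (by
      rintro _ ⟨x, rfl⟩
      obtain ⟨δ, rfl⟩ := ofLoop_surjective x
      -- The G̃-coordinate of a loop in E × G̃ contracts, so the class comes from E and the lifting
      -- criterion holds.
      have hδ : ofLoop δ = ofLoop ((δ.map continuous_fst).prod (Path.refl (1 : G'))) := by
        have hδ' : δ = (δ.map continuous_fst).prod (δ.map continuous_snd) := rfl
        conv_lhs => rw [hδ']
        exact ofLoop_eq_iff.2 ⟨Path.Homotopic.prodHomotopy (Path.Homotopy.refl _)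
          (SimplyConnectedSpace.paths_homotopic _ _).some⟩
      refine ⟨ofLoop (δ.map continuous_fst), ?_⟩
      rw [hδ, mapOfEq_ofLoop]
      refine congrArg ofLoop (Path.ext (funext fun t => ?_))
      exact (hf _).symm)
  have hμ : ∀ e g, p (μ (e, g)) = p e <• ρ g := fun e g => congrFun hμ (e, g)
  have hone : ∀ e, μ (e, 1) = e := fun e => by
    refine congrFun (cov.eq_of_comp_eq (μ.continuous.comp (Continuous.prodMk_left 1))
      continuous_id (funext fun e => ?_) e₀ hμ₀) e
    simp [hμ]
  have hmul : ∀ e g g', μ (μ (e, g), g') = μ (e, g * g') := fun e g g' => by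
    have h1 : Continuous fun x : E × G' × G' => μ (μ (x.1, x.2.1), x.2.2) := by fun_prop
    have h2 : Continuous fun x : E × G' × G' => μ (x.1, x.2.1 * x.2.2) := by fun_prop
    refine congrFun (cov.eq_of_comp_eq h1 h2 (funext fun x => ?_) (e₀, 1, 1) ?_) (e, g, g')
    · simp [hμ, mul_smul]
    · simp [hone]
  refine ⟨{ smul := fun g e => μ (e, g.unop)
            one_smul := hone
            mul_smul := fun g g' e => (hmul e g'.unop g.unop).symm }, ?_, ?_⟩
  · exact μ.continuous
  · exact hμ

variable [MulAction G'ᵐᵒᵖ E]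

theorem eq_one_of_smul_eq [PathConnectedSpace E] (h : IsPrincipalBundle m k n G π)
    (hρ : IsUniversalCoveringGroup k ρ) (cov : IsCoveringMap p)
    (hcont : Continuous (fun x : E × G' => x.1 <• x.2))
    (hsmul : ∀ (e : E) (g : G'), p (e <• g) = p e <• ρ g) {p₀ : P} {e₀ : E} (he₀ : p e₀ = p₀)
    (hinj : Function.Injective (h.orbitMapStar p₀))
    (hK : (mapOfEq ⟨p, cov.continuous⟩ he₀).range ⊓ (h.orbitMapStar p₀).range = ⊥)
    {e : E} {g : G'} (hg : e <• g = e) : g = 1 := by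
  have := hρ.simplyConnected
  have hρg : ρ g = 1 := h.free (p e) _ (by rw [← hsmul, hg])
  -- Translation by g lifts p and fixes e, so it is the identity. A path from 1 to g then yields a
  -- closed lift of a loop in i_*(π₁(G)), whose class lies in the trivial intersection.
  have hg₀ : e₀ <• g = e₀ := by
    refine congrFun (cov.eq_of_comp_eq (hcont.comp (Continuous.prodMk_left g))
      continuous_id (funext fun e => ?_) e hg) e₀
    simp [hsmul, hρg]
  let g' : Path (1 : G') g := PathConnectedSpace.somePath 1 g
  let γ : Path (1 : G) 1 := (g'.map hρ.isCoveringMap.continuous).cast (map_one ρ).symm hρg.symm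
  refine (hρ.ofLoop_eq_one_iff γ g' fun _ => rfl).1 (hinj ?_)
  rw [map_one, ← Subgroup.mem_bot, ← hK]
  refine ⟨?_, ofLoop γ, rfl⟩
  rw [h.orbitMapStar_ofLoop]
  refine (cov.ofLoop_mem_range_mapOfEq_iff he₀ _ ((g'.map (f := fun x => e₀ <• x)
    (hcont.comp (Continuous.prodMk_right e₀))).cast (one_smul _ _).symm rfl) fun t => ?_).2 hg₀
  rw [h.smulLoop_apply]
  refine (hsmul e₀ (g' t)).trans ?_
  rw [he₀]
  rfl

theorem exists_smul_eq [PathConnectedSpace E] (h : IsPrincipalBundle m k n G π)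
    (hρ : IsUniversalCoveringGroup k ρ) (cov : IsCoveringMap p)
    (hcont : Continuous (fun x : E × G' => x.1 <• x.2))
    (hsmul : ∀ (e : E) (g : G'), p (e <• g) = p e <• ρ g) {p₀ : P} {e₀ : E} (he₀ : p e₀ = p₀)
    (hK : (mapOfEq ⟨p, cov.continuous⟩ he₀).range ⊔ (h.orbitMapStar p₀).range = ⊤)
    {e e' : E} (hee' : p e = p e') : ∃ z : G', ρ z = 1 ∧ e <• z = e' := by
  have hbase : ∀ e', p e' = p₀ → ∃ z : G', ρ z = 1 ∧ e₀ <• z = e' := by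
    intro e' he'
    let B : Path e₀ e' := PathConnectedSpace.somePath e₀ e'
    let b : Path p₀ p₀ := (B.map cov.continuous).cast he₀.symm he'.symm
    have := MonoidHom.normal_range_of_commute (h.commute_orbitMapStar p₀)
    obtain ⟨x, hx, _, ⟨y, rfl⟩, hxy⟩ := Subgroup.mem_sup_of_normal_right.1
      (hK ▸ Subgroup.mem_top (ofLoop b))
    -- Multiplying b = x · i_*(y) by this loop leaves x, which lies in the image subgroup. Hence the
    -- lift B · g' closes up, and its endpoint e'z equals e₀.
    obtain ⟨g, hg⟩ := ofLoop_surjective y⁻¹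
    obtain ⟨z, g', hg'⟩ := hρ.isCoveringMap.exists_path_lift g (map_one ρ)
    have hz : ρ z = 1 := by simpa using hg' 1
    have hmem : ofLoop (h.smulLoop b g) ∈ (mapOfEq ⟨p, cov.continuous⟩ he₀).range := by
      rw [h.ofLoop_smulLoop, hg, ← hxy, map_inv, mul_inv_cancel_right]
      exact hx
    rw [cov.ofLoop_mem_range_mapOfEq_iff he₀ _ (((B.prod g').map
      (f := fun x : E × G' => x.1 <• x.2) hcont).cast (one_smul _ _).symm rfl) fun t => ?_] at hmem
    · refine ⟨z⁻¹, by rw [map_inv, hz, inv_one], ?_⟩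
      rw [← hmem, ← mul_smul, ← MulOpposite.op_mul]
      simp
    · rw [h.smulLoop_apply]
      refine (hsmul (B t) (g' t)).trans ?_
      rw [hg']
      rfl
  -- For arbitrary e, transport to the base fibre along A: Az and A' lift the same path and agree at
  -- time 1, hence also at time 0.
  let A : Path e e₀ := PathConnectedSpace.somePath e e₀
  obtain ⟨e₁, A', hA'⟩ := cov.exists_path_lift (A.map cov.continuous) hee'.symm
  obtain ⟨z, hz, hze₁⟩ := hbase e₁ (by
    have := hA' 1
    rwa [A'.target, Path.target, he₀] at this)
  refine ⟨z, hz, ?_⟩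
  have := congrFun (cov.eq_of_comp_eq (hcont.comp (A.continuous.prodMk continuous_const))
    A'.continuous (funext fun t => ?_) 1 (by simpa using hze₁)) 0
  · simpa using this
  · change p (A t <• z) = p (A' t)
    rw [hsmul, hz, hA']
    simp

end IsPrincipalBundle

end CoveringBundle

/-! ### The covering as a smooth principal bundle. -/

section CoveringBundle

variable {m k n : ℕ} {M : Type uM} {P : Type uP} {E : Type*} {G : Type uG} {G' : Type uH}
  [TopologicalSpace M] [ChartedSpace (EuclideanSpace ℝ (Fin m)) M]
  [TopologicalSpace P] [ChartedSpace (EuclideanSpace ℝ (Fin n)) P]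
  [TopologicalSpace G] [ChartedSpace (EuclideanSpace ℝ (Fin k)) G] [Group G]
  [TopologicalSpace G'] [ChartedSpace (EuclideanSpace ℝ (Fin k)) G'] [Group G']
  [MulAction Gᵐᵒᵖ P] {ρ : G' →* G} {π : P → M}
  [TopologicalSpace E] [ChartedSpace (EuclideanSpace ℝ (Fin n)) E] [MulAction G'ᵐᵒᵖ E] {p : E → P}

namespace IsPrincipalBundle

theorem exists_trivialization_lift (h : IsPrincipalBundle m k n G π)
    (hρ : IsLocalDiffeomorph (𝓡 k) (𝓡 k) ∞ ρ)
    (hp : IsLocalDiffeomorph (𝓡 n) (𝓡 n) ∞ p) (hps : Function.Surjective p)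
    (hcont : ContMDiff ((𝓡 n).prod (𝓡 k)) (𝓡 n) ∞ (fun x : E × G' => x.1 <• x.2))
    (hsmul : ∀ (e : E) (g : G'), p (e <• g) = p e <• ρ g)
    (hfree : ∀ (e : E) (g : G'), e <• g = e → g = 1)
    (htrans : ∀ e e' : E, π (p e) = π (p e') → ∃ g : G', e <• g = e') (x : M) :
    ∃ t : Bundle.Trivialization G' (fun e => π (p e)), x ∈ t.baseSet ∧
      ContMDiffOn (𝓡 n) ((𝓡 m).prod (𝓡 k)) ∞ t t.source ∧
      ContMDiffOn ((𝓡 m).prod (𝓡 k)) (𝓡 n) ∞ t.toOpenPartialHomeomorph.symm t.target ∧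
      ∀ e ∈ t.source, ∀ g : G', (t (e <• g)).2 = (t e).2 * g := by
  classical
  obtain ⟨c, hxc, hc, hc', hceq⟩ := h.locally_trivial x
  have hcancel : ∀ {e : E} {a b : G'}, e <• a = e <• b → a = b := fun {e a b} hab => by
    refine mul_inv_eq_one.1 (hfree e _ ?_)
    rw [MulOpposite.op_mul, mul_smul, hab, ← mul_smul, ← MulOpposite.op_mul]
    simp
  let s : M → P := fun y => c.toOpenPartialHomeomorph.symm (y, 1)
  have hs : ContMDiffOn (𝓡 m) (𝓡 n) ∞ s c.baseSet :=
    hc'.comp (contMDiffOn_id.prodMk contMDiffOn_const) fun y hy => c.mem_target.2 hy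
  have hsc : ∀ y ∈ c.baseSet, s y ∈ c.source := fun y hy => c.map_target (c.mem_target.2 hy)
  have hπs : ∀ y ∈ c.baseSet, π (s y) = y := fun y hy => c.proj_symm_apply' hy
  have hsd : ∀ q : P, π q ∈ c.baseSet → ∀ g : G, s (π q) <• g = q ↔ (c q).2 = g := by
    intro q hq g
    have hcs : c (s (π q)) = (π q, 1) := c.apply_symm_apply' hq
    have h2 : (c (s (π q) <• g)).2 = g := by rw [hceq _ (hsc _ hq), hcs, one_mul]
    constructor
    · intro hg
      rw [← h2, hg]
    · rintro rfl
      have hmem : s (π q) <• (c q).2 ∈ c.source := by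
        rw [c.mem_source, h.proj_smul, hπs _ hq]
        exact hq
      refine c.injOn hmem (c.mem_source.2 hq) (Prod.ext ?_ h2)
      refine (c.coe_fst hmem).trans (Eq.trans ?_ (c.coe_fst' hq).symm)
      rw [h.proj_smul, hπs _ hq]
  obtain ⟨e₁, he₁⟩ := hps (s x)
  have hl := hp e₁
  let V : Set M := c.baseSet ∩ s ⁻¹' hl.localInverse.source
  have hV : IsOpen V := hs.continuousOn.isOpen_inter_preimage c.open_baseSet
    hl.localInverse_open_source
  have hxV : x ∈ V := ⟨hxc, by
    rw [Set.mem_preimage, ← he₁]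
    exact hl.localInverse_mem_source⟩
  -- A smooth local section of E, obtained by lifting one of P through a local inverse of p.
  let σ : M → E := fun y => hl.localInverse (s y)
  have hσ : ContMDiffOn (𝓡 m) (𝓡 n) ∞ σ V :=
    hl.localInverse_contMDiffOn.comp (hs.mono Set.inter_subset_left) fun y hy => hy.2
  have hpσ : ∀ y ∈ V, p (σ y) = s y := fun y hy => hl.localInverse_right_inv hy.2
  have hex : ∀ e, ∃ g : G', π (p e) ∈ V → σ (π (p e)) <• g = e := fun e => by
    by_cases he : π (p e) ∈ V
    · obtain ⟨g, hg⟩ := htrans (σ (π (p e))) e (by rw [hpσ _ he, hπs _ he.1])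
      exact ⟨g, fun _ => hg⟩
    · exact ⟨1, fun h => absurd h he⟩
  choose d hd using hex
  have hproj : ContMDiff (𝓡 n) (𝓡 m) ∞ fun e => π (p e) := h.contMDiff_proj.comp hp.contMDiff
  have hW : IsOpen ((fun e => π (p e)) ⁻¹' V) := hV.preimage hproj.continuous
  have hρd : ∀ e, π (p e) ∈ V → (c (p e)).2 = ρ (d e) := fun e he => by
    rw [← hsd _ he.1, ← hpσ _ he, ← hsmul, hd e he]
  have hdsmooth : ContMDiffOn (𝓡 n) (𝓡 k) ∞ d ((fun e => π (p e)) ⁻¹' V) := by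
    intro e he
    have he : π (p e) ∈ V := he
    have hr := hρ (d e)
    have hcp : ContMDiffAt (𝓡 n) (𝓡 k) ∞ (fun e => (c (p e)).2) e := by
      have h1 : ContMDiffAt (𝓡 n) ((𝓡 m).prod (𝓡 k)) ∞ c (p e) :=
        hc.contMDiffAt (c.open_source.mem_nhds (c.mem_source.2 he.1))
      exact contMDiff_snd.contMDiffAt.comp e (h1.comp e (hp.contMDiff e))
    have hd' : ContMDiffAt (𝓡 n) (𝓡 k) ∞ (fun e => hr.localInverse (c (p e)).2) e := by
      have h1 : ContMDiffAt (𝓡 k) (𝓡 k) ∞ hr.localInverse (c (p e)).2 := by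
        rw [hρd e he]
        exact hr.localInverse_contMDiffAt
      exact ContMDiffAt.comp e h1 hcp
    refine (hd'.congr_of_eventuallyEq ?_).contMDiffWithinAt
    have hσ' : ContMDiffAt (𝓡 n) (𝓡 n) ∞ (fun e => σ (π (p e))) e :=
      ContMDiffAt.comp (f := fun e => π (p e)) (g := σ) e (hσ.contMDiffAt (hV.mem_nhds he)) (hproj e)
    have hlift : ContinuousAt (fun e => σ (π (p e)) <• hr.localInverse (c (p e)).2) e :=
      (ContMDiffAt.comp e hcont.contMDiffAt (hσ'.prodMk hd')).continuousAt
    have hnhds : ∀ᶠ e' in nhds e, (c (p e')).2 ∈ hr.localInverse.source := by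
      refine hcp.continuousAt.eventually (hr.localInverse_open_source.mem_nhds ?_)
      simp only [hρd e he]
      exact hr.localInverse_mem_source
    -- The choice d is not known to be continuous. Its smooth candidate, a local inverse of ρ
    -- applied to the coordinate in P, reproduces the identity of E after applying p and at e
    -- itself. Local uniqueness of lifts, with freeness, then identifies it with d near e.
    have heq := hp.isLocalHomeomorph.eventuallyEq_of_comp_eventuallyEq hlift continuousAt_id (by
      change σ (π (p e)) <• hr.localInverse (c (p e)).2 = e
      rw [hρd e he, hr.localInverse_left_inv hr.localInverse_mem_target, hd e he]) (by
      filter_upwards [hW.mem_nhds he, hnhds] with e' he' he''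
      have he' : π (p e') ∈ V := he'
      change p (σ (π (p e')) <• hr.localInverse (c (p e')).2) = p e'
      rw [hsmul, hr.localInverse_right_inv he'', hpσ _ he', hsd _ he'.1])
    filter_upwards [heq, hW.mem_nhds he] with e' he' hV'
    exact hcancel ((hd e' hV').trans he'.symm)
  have hπσ : ∀ y ∈ V, ∀ g : G', π (p (σ y <• g)) = y := fun y hy g => by
    rw [hsmul, h.proj_smul, hpσ y hy, hπs y hy.1]
  have hdσ : ∀ y ∈ V, ∀ g : G', d (σ y <• g) = g := fun y hy g => by
    have h1 := hd (σ y <• g) (by rwa [hπσ y hy])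
    rw [hπσ y hy] at h1
    exact hcancel h1
  have hto : ContMDiffOn (𝓡 n) ((𝓡 m).prod (𝓡 k)) ∞ (fun e => (π (p e), d e))
      ((fun e => π (p e)) ⁻¹' V) := hproj.contMDiffOn.prodMk hdsmooth
  have hinv : ContMDiffOn ((𝓡 m).prod (𝓡 k)) (𝓡 n) ∞ (fun y : M × G' => σ y.1 <• y.2)
      (V ×ˢ Set.univ) :=
    hcont.comp_contMDiffOn ((hσ.comp contMDiffOn_fst fun y hy => hy.1).prodMk contMDiffOn_snd)
  let t : Bundle.Trivialization G' (fun e => π (p e)) :=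
    { toFun := fun e => (π (p e), d e)
      invFun := fun y => σ y.1 <• y.2
      source := (fun e => π (p e)) ⁻¹' V
      target := V ×ˢ Set.univ
      map_source' := fun e he => ⟨he, Set.mem_univ _⟩
      map_target' := fun y hy => by
        rw [Set.mem_preimage, hπσ y.1 hy.1]
        exact hy.1
      left_inv' := fun e he => hd e he
      right_inv' := fun y hy => Prod.ext (hπσ y.1 hy.1 y.2) (hdσ y.1 hy.1 y.2)
      open_source := hW
      open_target := hV.prod isOpen_univ
      continuousOn_toFun := hto.continuousOn
      continuousOn_invFun := hinv.continuousOn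
      baseSet := V
      open_baseSet := hV
      source_eq := rfl
      target_eq := rfl
      proj_toFun := fun _ _ => rfl }
  refine ⟨t, hxV, hto, hinv, fun e he g => ?_⟩
  change d (e <• g) = d e * g
  have he : π (p e) ∈ V := he
  have hπg : π (p (e <• g)) = π (p e) := by rw [hsmul, h.proj_smul]
  have h1 := hd (e <• g) (by rwa [hπg])
  rw [hπg] at h1
  refine hcancel (h1.trans ?_)
  rw [MulOpposite.op_mul, mul_smul, hd e he]

theorem isPrincipalBundle_lift (h : IsPrincipalBundle m k n G π)
    (hρ : IsLocalDiffeomorph (𝓡 k) (𝓡 k) ∞ ρ) (hρs : Function.Surjective ρ)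
    (hp : IsLocalDiffeomorph (𝓡 n) (𝓡 n) ∞ p) (hps : Function.Surjective p)
    (hcont : Continuous (fun x : E × G' => x.1 <• x.2))
    (hsmul : ∀ (e : E) (g : G'), p (e <• g) = p e <• ρ g)
    (hfree : ∀ (e : E) (g : G'), e <• g = e → g = 1)
    (htrans : ∀ e e' : E, p e = p e' → ∃ z : G', ρ z = 1 ∧ e <• z = e') :
    IsPrincipalBundle m k n G' (fun e => π (p e)) := by
  have hact : ContMDiff ((𝓡 n).prod (𝓡 k)) (𝓡 n) ∞ (fun x : E × G' => x.1 <• x.2) := by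
    refine hp.contMDiff_of_comp hcont ?_
    simp only [hsmul]
    exact h.contMDiff_action.comp
      ((hp.contMDiff.comp contMDiff_fst).prodMk (hρ.contMDiff.comp contMDiff_snd))
  have htrans' : ∀ e e' : E, π (p e) = π (p e') → ∃ g : G', e <• g = e' := by
    intro e e' hee'
    obtain ⟨g, hg⟩ := h.transitive _ _ hee'
    obtain ⟨g', rfl⟩ := hρs g
    obtain ⟨z, -, hz⟩ := htrans (e <• g') e' (by rw [hsmul, hg])
    exact ⟨g' * z, by rw [MulOpposite.op_mul, mul_smul, hz]⟩
  exact
    { contMDiff_proj := h.contMDiff_proj.comp hp.contMDiff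
      surjective_proj := h.surjective_proj.comp hps
      contMDiff_action := hact
      proj_smul := fun e g => by rw [hsmul, h.proj_smul]
      transitive := htrans'
      free := hfree
      locally_trivial := h.exists_trivialization_lift hρ hp hps hact hsmul hfree htrans' }

end IsPrincipalBundle

end CoveringBundle

/-! ### From complements to spinor structures. -/

section Existence

variable {m k n : ℕ} {M : Type uM} {P : Type uP} {G : Type uG} {G' : Type uH}
  [TopologicalSpace M] [SecondCountableTopology M] [ConnectedSpace M]
  [ChartedSpace (EuclideanSpace ℝ (Fin m)) M]
  [TopologicalSpace P] [T2Space P]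
  [ChartedSpace (EuclideanSpace ℝ (Fin n)) P] [IsManifold (𝓡 n) ∞ P]
  [TopologicalSpace G] [ConnectedSpace G]
  [ChartedSpace (EuclideanSpace ℝ (Fin k)) G] [Group G]
  [TopologicalSpace G'] [SecondCountableTopology G']
  [ChartedSpace (EuclideanSpace ℝ (Fin k)) G'] [Group G'] [LieGroup (𝓡 k) ∞ G']
  [MulAction Gᵐᵒᵖ P] {ρ : G' →* G} {π : P → M}

theorem SpinorStructure.exists_imageSubgroup_eq (hρ : IsUniversalCoveringGroup k ρ)
    (hπ : IsPrincipalBundle m k n G π) {p₀ : P} (hinj : Function.Injective (hπ.orbitMapStar p₀))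
    {K : Subgroup (FundamentalGroup P p₀)} (hK : hπ.IsComplement p₀ K) :
    ∃ (S : SpinorStructure m k n ρ π) (q₀ : S.Q) (hq₀ : S.spinorMap q₀ = p₀),
      S.imageSubgroup q₀ hq₀ = K := by
  have := hπ.connectedSpace
  have : LocallyPathConnectedSpace P :=
    ChartedSpace.locallyPathConnectedSpace (EuclideanSpace ℝ (Fin n)) P
  have : PathConnectedSpace P :=
    ChartedSpace.pathConnectedSpace_of_connectedSpace (EuclideanSpace ℝ (Fin n))
  obtain ⟨E, _, p, cov, e₀, he₀, _, hrange⟩ := exists_isCoveringMap_range_eq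
    (ChartedSpace.exists_simplyConnected_nhds (n := n)) K
  let _ : ChartedSpace (EuclideanSpace ℝ (Fin n)) E := cov.isLocalHomeomorph.pullbackChartedSpace
  have : IsManifold (𝓡 n) ∞ E := cov.isLocalHomeomorph.isManifold_pullback
  have hp : IsLocalDiffeomorph (𝓡 n) (𝓡 n) ∞ p :=
    cov.isLocalHomeomorph.isLocalDiffeomorph_pullback
  have : LocallyPathConnectedSpace E :=
    ChartedSpace.locallyPathConnectedSpace (EuclideanSpace ℝ (Fin n)) E
  have : ContinuousMul G' := continuousMul_of_contMDiffMul (𝓡 k) ∞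
  obtain ⟨_, hcont, hsmul⟩ := hπ.exists_mulAction_lift hρ cov
  have hbundle := hπ.isPrincipalBundle_lift hρ.isLocalDiffeomorph hρ.surjective hp
    cov.surjective_of_connected hcont hsmul
    (fun e g => hπ.eq_one_of_smul_eq hρ cov hcont hsmul he₀ hinj (hrange ▸ hK.inf_eq_bot))
    (fun e e' => hπ.exists_smul_eq hρ cov hcont hsmul he₀ (hrange ▸ hK.sup_eq_top))
  have := hbundle.secondCountableTopology
  have := cov.t2Space
  exact ⟨{ Q := E
           proj := fun e => π (p e)
           isPrincipalBundle := hbundle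
           spinorMap := p
           contMDiff_spinorMap := hp.contMDiff
           spinorMap_smul := hsmul
           proj_spinorMap := fun _ => rfl }, e₀, he₀, hrange⟩

end Existence

/-! ### The classification. -/

namespace SpinorStructure

variable {m k n : ℕ} {M : Type uM} {P : Type uP} {G : Type uG} {G' : Type uH}
  [TopologicalSpace M] [ChartedSpace (EuclideanSpace ℝ (Fin m)) M]
  [TopologicalSpace P] [ChartedSpace (EuclideanSpace ℝ (Fin n)) P]
  [Group G] [TopologicalSpace G'] [ChartedSpace (EuclideanSpace ℝ (Fin k)) G'] [Group G']
  [MulAction Gᵐᵒᵖ P] {ρ : G' →* G} {π : P → M}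

theorem Equivalent.refl (S : SpinorStructure m k n ρ π) : S.Equivalent S :=
  ⟨id, contMDiff_id, fun _ _ => rfl, fun _ => rfl, fun _ => rfl⟩

theorem Equivalent.trans {S T U : SpinorStructure m k n ρ π} (hST : S.Equivalent T)
    (hTU : T.Equivalent U) : S.Equivalent U := by
  obtain ⟨a, ha, hsmul, hproj, hmap⟩ := hST
  obtain ⟨b, hb, hsmul', hproj', hmap'⟩ := hTU
  refine ⟨b ∘ a, hb.comp ha, fun q g => ?_, fun q => ?_, fun q => ?_⟩
  · simp only [Function.comp_apply, hsmul, hsmul']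
  · exact (hproj' _).trans (hproj q)
  · exact (hmap' _).trans (hmap q)

variable [TopologicalSpace G] [ChartedSpace (EuclideanSpace ℝ (Fin k)) G]
  [LieGroup (𝓡 k) ∞ G] [LieGroup (𝓡 k) ∞ G'] [ConnectedSpace G] [ConnectedSpace M]

theorem Equivalent.symm {S T : SpinorStructure m k n ρ π} (hST : S.Equivalent T)
    (hρ : IsUniversalCoveringGroup k ρ) (hπ : IsPrincipalBundle m k n G π) {p₀ : P}
    (hex : hπ.ExistenceCondition p₀) : T.Equivalent S := by
  obtain ⟨q₀, hq₀⟩ := S.exists_spinorMap_eq hρ hπ p₀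
  obtain ⟨q₁, hq₁⟩ := T.exists_spinorMap_eq hρ hπ p₀
  exact equivalent_of_imageSubgroup_eq hρ hπ hq₁ hq₀ (hST.imageSubgroup_eq hρ hπ hex hq₀ hq₁).ge

end SpinorStructure

namespace SpinorClass

variable {m k n : ℕ} {M : Type uM} {P : Type uP} {G : Type uG} {G' : Type uH}
  [TopologicalSpace M] [ChartedSpace (EuclideanSpace ℝ (Fin m)) M]
  [TopologicalSpace P] [ChartedSpace (EuclideanSpace ℝ (Fin n)) P]
  [Group G] [TopologicalSpace G'] [ChartedSpace (EuclideanSpace ℝ (Fin k)) G'] [Group G']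
  [MulAction Gᵐᵒᵖ P] {ρ : G' →* G} {π : P → M}
  [TopologicalSpace G] [ChartedSpace (EuclideanSpace ℝ (Fin k)) G]
  [LieGroup (𝓡 k) ∞ G] [LieGroup (𝓡 k) ∞ G'] [ConnectedSpace G] [ConnectedSpace M]

/-- The complement `u_*(π₁(Q))` attached to the class of a spinor structure `u : Q → P`. -/
noncomputable def complement (hρ : IsUniversalCoveringGroup k ρ)
    (hπ : IsPrincipalBundle m k n G π) {p₀ : P} (hex : hπ.ExistenceCondition p₀)
    (c : SpinorClass m k n ρ π) :
    {K : Subgroup (FundamentalGroup P p₀) // hπ.IsComplement p₀ K} :=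
  Quot.lift (fun S => ⟨S.imageSubgroup _ (S.exists_spinorMap_eq hρ hπ p₀).choose_spec,
    S.isComplement_imageSubgroup hρ hπ hex _⟩)
    (fun _ _ hST => Subtype.ext (hST.imageSubgroup_eq hρ hπ hex _ _)) c

theorem complement_toClass (hρ : IsUniversalCoveringGroup k ρ)
    (hπ : IsPrincipalBundle m k n G π) {p₀ : P} (hex : hπ.ExistenceCondition p₀)
    (S : SpinorStructure m k n ρ π) {q₀ : S.Q} (hq₀ : S.spinorMap q₀ = p₀) :
    (complement hρ hπ hex S.toClass : Subgroup (FundamentalGroup P p₀)) =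
      S.imageSubgroup q₀ hq₀ :=
  S.imageSubgroup_eq hπ _ hq₀

theorem complement_injective (hρ : IsUniversalCoveringGroup k ρ)
    (hπ : IsPrincipalBundle m k n G π) {p₀ : P} (hex : hπ.ExistenceCondition p₀) :
    Function.Injective (complement hρ hπ hex) := by
  rintro ⟨S⟩ ⟨T⟩ hST
  exact Quot.sound (SpinorStructure.equivalent_of_imageSubgroup_eq hρ hπ _ _
    (congrArg Subtype.val hST).le)

end SpinorClass

theorem mainTheorem2 {m k n : ℕ} {M : Type uM} {P : Type uP} {G : Type uG} {G' : Type uH}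
    [TopologicalSpace M] [T2Space M] [SecondCountableTopology M] [ConnectedSpace M]
    [ChartedSpace (EuclideanSpace ℝ (Fin m)) M] [IsManifold (𝓡 m) ∞ M]
    [TopologicalSpace P] [T2Space P] [SecondCountableTopology P]
    [ChartedSpace (EuclideanSpace ℝ (Fin n)) P] [IsManifold (𝓡 n) ∞ P]
    [TopologicalSpace G] [T2Space G] [SecondCountableTopology G] [ConnectedSpace G]
    [ChartedSpace (EuclideanSpace ℝ (Fin k)) G] [Group G] [LieGroup (𝓡 k) ∞ G]
    [TopologicalSpace G'] [T2Space G'] [SecondCountableTopology G']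
    [ChartedSpace (EuclideanSpace ℝ (Fin k)) G'] [Group G'] [LieGroup (𝓡 k) ∞ G']
    (ρ : G' →* G) (hρ : IsUniversalCoveringGroup k ρ)
    [MulAction Gᵐᵒᵖ P] (π : P → M) (hπ : IsPrincipalBundle m k n G π) (p₀ : P)
    (hex : hπ.ExistenceCondition p₀) :
    -- equivalence of spinor structures is an equivalence relation, and
    Equivalence (SpinorStructure.Equivalent (m := m) (k := k) (n := n) (ρ := ρ) (π := π)) ∧
    -- the class of `u : Q → P` is determined by the complement `u_*(π₁(Q))`, which is arbitrary;
    ∃ κ : SpinorClass m k n ρ π ≃ {K : Subgroup (FundamentalGroup P p₀) // hπ.IsComplement p₀ K},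
      (∀ (S : SpinorStructure m k n ρ π) (q₀ : S.Q) (hq₀ : S.spinorMap q₀ = p₀),
        (κ S.toClass : Subgroup (FundamentalGroup P p₀)) = S.imageSubgroup q₀ hq₀) ∧
      -- relative to any fixed `S₀`, the classes correspond to homomorphisms `π₁(M) → π₁(G)`.
      ∀ S₀ : SpinorStructure m k n ρ π,
        ∃ Φ : SpinorClass m k n ρ π ≃ (FundamentalGroup M (π p₀) →* FundamentalGroup G (1 : G)),
          Φ S₀.toClass = 1 ∧
          ∀ (c : SpinorClass m k n ρ π) (x : FundamentalGroup P p₀),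
            x ∈ (κ c : Subgroup (FundamentalGroup P p₀)) ↔
              ∃ y ∈ (κ S₀.toClass : Subgroup (FundamentalGroup P p₀)),
                x = y * hπ.orbitMapStar p₀ (Φ c (hπ.projStar p₀ y)) := by
  refine ⟨⟨fun S => .refl S, fun hST => hST.symm hρ hπ hex, fun hST hTU => hST.trans hTU⟩, ?_⟩
  have hsurj : Function.Surjective (SpinorClass.complement hρ hπ hex) := fun ⟨K, hK⟩ => by
    obtain ⟨S, q₀, hq₀, hS⟩ := SpinorStructure.exists_imageSubgroup_eq hρ hπ hex.1 hK
    exact ⟨S.toClass, Subtype.ext ((SpinorClass.complement_toClass hρ hπ hex S hq₀).trans hS)⟩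
  let κ := Equiv.ofBijective _ ⟨SpinorClass.complement_injective hρ hπ hex, hsurj⟩
  refine ⟨κ, fun S q₀ hq₀ => SpinorClass.complement_toClass hρ hπ hex S hq₀, fun S₀ => ?_⟩
  -- Read the complement of a class as a twist of the complement of S₀; the trivial twist returns
  -- S₀.
  refine ⟨κ.trans (hπ.homEquivComplement hex (κ S₀.toClass).2).symm, ?_, fun c x => ?_⟩
  · rw [Equiv.trans_apply, Equiv.symm_apply_eq, hπ.homEquivComplement_one]
  · rw [← hπ.mem_homEquivComplement hex (κ S₀.toClass).2, Equiv.trans_apply,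
      Equiv.apply_symm_apply]
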